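/- **Theorem (Equivalence of RTFEM and NCFEM).** Let $\Omega\subset\mathbb R^2$ be open with $\Omega=\operatorname{int}\overline\Omega$ (for example a bounded, simply connected, polygonal Lipschitz domain), and let $\mathcal T$ be a regular triangulation of $\overline\Omega$: a finite set of nondegenerate closed triangles with $\bigcup_{T\in\mathcal T}T=\overline\Omega$, two distinct ones of which are disjoint or share exactly one common vertex or exactly one common edge. Let $\mathbf A\in L^\infty(\Omega;\mathbb R^{2\times2}_{sym})$ satisfy $\alpha|\xi|^2\le \mathbf A(x)\xi\cdot\xi\le\Lambda|\xi|^2$ for a.e. $x\in\Omega$ and all $\xi\in\mathbb R^2$, with some $\alpha>0$ and $\Lambda$, and let $\mathbf b\in L^\infty(\Omega;\mathbb R^2)$, $\gamma\in L^\infty(\Omega)$, $f\in L^2(\Omega)$. Notation. $P_0(\mathcal T)$ is the space of piecewise constant functions, $\Pi_0$ the $L^2$ projection onto piecewise constants, $\mathbf A_h=\Pi_0\mathbf A$, $\mathbf b_h=\Pi_0\mathbf b$, $\gamma_h=\Pi_0\gamma$, $f_h=\Pi_0f$, $\mathbf b_h^*=\mathbf A_h^{-1}\mathbf b_h$; $\nabla_{NC}$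 is the piecewise gradient and $(\cdot,\cdot)$ the scalar product of $L^2(\Omega)$. $CR^1_0(\mathcal T)$ is the space of piecewise affine functions that are continuous at the midpoints of all edges and vanish at the midpoints of the boundary edges. $RT_0(\mathcal T)$ is the space of all $\mathbf q\in H(\mathrm{div},\Omega)$ that are of the form $\mathbf q(x)=\mathbf c_T+d_Tx$ on each $T\in\mathcal T$ ($\mathbf c_T\in\mathbb R^2$, $d_T\in\mathbb R$) and have vanishing normal jumps $[\mathbf q]_E\cdot\nu_E=0$ across all interior edges $E$. Set $$S(T)=\frac1{|T|}\int_T (x-\mathrm{mid}(T))\cdot\mathbf A_h^{-1}(x-\mathrm{mid}(T))\,dx ,$$ where $\mathrm{mid}(T)$ is the centroid of $T$, and assume that $1+\tfrac{S(T)}4\gamma_h|_T\neq0$ for all $T\in\mathcal T$ (this holds for all sufficiently small mesh-sizes). For $\tilde u_{CR}\in CR^1_0(\mathcal T)$ define, on each $T\in\mathcal T$, $$\tilde u_M=\Big(1+\frac{S(T)}4\gamma_h\Big)^{-1}\Big(\Pi_0\tilde u_{CR}+\frac{S(T)}4f_h\Big),\tag{1}$$ $$\tilde{\mathbf p}_M(x)=-\big(\mathbf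 A_h\nabla_{NC}\tilde u_{CR}+\tilde u_M\mathbf b_h\big)+\big(f_h-\gamma_h\tilde u_M\big)\frac{x-\mathrm{mid}(T)}2 .\tag{2}$$ The modified Crouzeix–Raviart problem seeks $\tilde u_{CR}\in CR_0^1(\mathcal T)$ such that, with $\tilde u_M$ from (1), $$(\mathbf A_h\nabla_{NC}\tilde u_{CR}+\tilde u_M\mathbf b_h,\nabla_{NC}v_{CR})+(\gamma_h\tilde u_M,v_{CR})=(f_h,v_{CR})\quad\text{for all }v_{CR}\in CR^1_0(\mathcal T).\tag{3}$$ The mixed scheme seeks $(\mathbf p_M,u_M)\in RT_0(\mathcal T)\times P_0(\mathcal T)$ such that $$(\mathbf A_h^{-1}\mathbf p_M+u_M\mathbf b_h^*,\mathbf q_{RT})-(\operatorname{div}\mathbf q_{RT},u_M)=0\quad\text{for all }\mathbf q_{RT}\in RT_0(\mathcal T),$$ $$(\operatorname{div}\mathbf p_M,v_h)+(\gamma_hu_M,v_h)=(f_h,v_h)\quad\text{for all }v_h\in P_0(\mathcal T).\tag{4}$$ Claim. (a) If $\tilde u_{CR}\in CR^1_0(\mathcal T)$ solves (3), then (2) defines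 $\tilde{\mathbf p}_M\in RT_0(\mathcal T)$, and $(\tilde{\mathbf p}_M,\tilde u_M)$ solves (4). (b) Conversely, for any solution $(\tilde{\mathbf p}_M,\tilde u_M)\in RT_0(\mathcal T)\times P_0(\mathcal T)$ of (4) there is exactly one solution $\tilde u_{CR}\in CR^1_0(\mathcal T)$ of (3) that satisfies (1) and (2). In particular, if (3) has a unique solution, then that solution satisfies (1) and (2). -/

import Mathlib

open MeasureTheory Set
open scoped ContDiff RealInnerProductSpace

noncomputable section

/-- The Euclidean plane. -/
abbrev Plane : Type := EuclideanSpace ℝ (Fin 2)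

/-- The closed convex hull of a finite set of vertices (a triangle, an edge or a point). -/
def hull (s : Finset Plane) : Set Plane := convexHull ℝ (s : Set Plane)

/-- The barycentre of a finite set of vertices: the midpoint of an edge, the centroid of a
triangle. -/
def mid (s : Finset Plane) : Plane := (s.card : ℝ)⁻¹ • ∑ x ∈ s, x

/-- The action of a `2 × 2` matrix on the plane. -/
def act (M : Matrix (Fin 2) (Fin 2) ℝ) (v : Plane) : Plane := Matrix.toEuclideanLin M v

/-- `g ∈ L²(Ω)` is the distributional divergence of the vector field `q` on `Ω`. -/
def IsWeakDiv (Ω : Set Plane) (q : Plane → Plane) (g : Plane → ℝ) : Prop :=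
  MemLp g 2 (volume.restrict Ω) ∧
    ∀ φ : Plane → ℝ, ContDiff ℝ ∞ φ → HasCompactSupport φ → tsupport φ ⊆ Ω →
      ∫ x in Ω, ⟪q x, gradient φ x⟫ = -∫ x in Ω, g x * φ x

/-- Membership in `H(div, Ω)`. -/
def MemHdiv (Ω : Set Plane) (q : Plane → Plane) : Prop :=
  MemLp q 2 (volume.restrict Ω) ∧ ∃ g, IsWeakDiv Ω q g

open Classical in
/-- The distributional divergence of `q ∈ H(div, Ω)`, unique up to null sets
(and `0` if there is none in `L²(Ω)`). -/
def weakDiv (Ω : Set Plane) (q : Plane → Plane) : Plane → ℝ :=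
  if h : ∃ g, IsWeakDiv Ω q g then h.choose else 0

/-- A regular triangulation of (the closure of) `Ω`: finitely many nondegenerate closed triangles,
each given by its set of three vertices, which cover the closure of `Ω`; two of them meet exactly
in the hull of their common vertices, so two distinct ones meet in nothing, a common vertex or a
common edge. -/
structure Triangulation (Ω : Set Plane) where
  cells : Finset (Finset Plane)
  card_eq : ∀ K ∈ cells, K.card = 3
  affineIndependent : ∀ K ∈ cells, AffineIndependent ℝ (fun x : K => (x : Plane))
  conforming : ∀ K ∈ cells, ∀ L ∈ cells,
    hull K ∩ hull L = convexHull ℝ ((K : Set Plane) ∩ (L : Set Plane))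
  cover : ⋃ K ∈ cells, hull K = closure Ω

namespace Triangulation

variable {Ω : Set Plane} (T : Triangulation Ω)

/-- The triangles of the triangulation. -/
abbrev Cell : Type := {K : Finset Plane // K ∈ T.cells}

/-- `E` is an edge of the triangle `K`. -/
def IsEdgeOf (E : Finset Plane) (K : T.Cell) : Prop := E.card = 2 ∧ E ⊆ K.1

/-- `E` is a boundary edge: an edge of one triangle only. -/
def IsBoundaryEdge (E : Finset Plane) : Prop := ∃! K : T.Cell, T.IsEdgeOf E K

/-- A piecewise function, given by a family of functions indexed by the triangles, as a function
on the plane: on the interior of each triangle `K` it is the member of the family with index `K`;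
it is `0` elsewhere, that is, on the edges (a null set) and outside the triangulated set. -/
def glue {V : Type} [AddCommMonoid V] (g : T.Cell → Plane → V) (x : Plane) : V :=
  ∑ K : T.Cell, (interior (hull K.1)).indicator (g K) x

/-- Piecewise constant functions `P₀(T)`, by their values on the triangles. -/
abbrev P0 : Type := T.Cell → ℝ

/-- A piecewise constant (in any space of values) as a function on the plane. -/
def const {V : Type} [AddCommMonoid V] (w : T.Cell → V) : Plane → V := T.glue fun K _ => w K

/-- The piecewise gradient of a piecewise smooth function. -/
def gradNC (v : T.Cell → Plane → ℝ) (K : T.Cell) (x : Plane) : Plane := gradient (v K) x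

/-- The space `CR¹₀(T)`: piecewise affine functions (given by the affine functions on the
triangles) that are continuous at the midpoints of the edges and vanish at the midpoints of the
boundary edges. -/
structure IsCR0 (v : T.Cell → Plane → ℝ) : Prop where
  affine : ∀ K, ∃ (a : Plane) (c : ℝ), ∀ x, v K x = ⟪a, x⟫ + c
  continuous_mid : ∀ E K L, T.IsEdgeOf E K → T.IsEdgeOf E L → v K (mid E) = v L (mid E)
  boundary : ∀ E K, T.IsBoundaryEdge E → T.IsEdgeOf E K → v K (mid E) = 0

/-- The lowest-order Raviart-Thomas space `RT₀(T)` (given by the polynomials `c + d x` on the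
triangles): fields in `H(div, Ω)` with vanishing jumps of the normal components across the
interior edges. -/
structure IsRT0 (q : T.Cell → Plane → Plane) : Prop where
  shape : ∀ K, ∃ (c : Plane) (d : ℝ), ∀ x, q K x = c + d • x
  memHdiv : MemHdiv Ω (T.glue q)
  jump : ∀ E K L, K ≠ L → T.IsEdgeOf E K → T.IsEdgeOf E L →
    ∀ ν : Plane, ‖ν‖ = 1 → (∀ x ∈ E, ∀ y ∈ E, ⟪x - y, ν⟫ = 0) →
      ∀ x ∈ hull E, ⟪q K x - q L x, ν⟫ = 0

/-- The `L²` projection `Π₀` onto piecewise constants: integral means over the triangles. -/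
def proj {V : Type} [NormedAddCommGroup V] [NormedSpace ℝ V] (g : Plane → V) (K : T.Cell) : V :=
  ⨍ x in hull K.1, g x

/-- The projection `Π₀` of a matrix field, entry by entry. -/
def projMat (A : Plane → Matrix (Fin 2) (Fin 2) ℝ) (K : T.Cell) : Matrix (Fin 2) (Fin 2) ℝ :=
  Matrix.of fun i j => T.proj (fun x => A x i j) K

/-- `S(T) = |T|⁻¹ ∫_T (x - mid T) · A_h⁻¹ (x - mid T) dx`. -/
def S (A : Plane → Matrix (Fin 2) (Fin 2) ℝ) (K : T.Cell) : ℝ :=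
  ⨍ x in hull K.1, ⟪x - mid K.1, act (T.projMat A K)⁻¹ (x - mid K.1)⟫

/-- `ũ_M = (1 + S(T) γ_h / 4)⁻¹ (Π₀ u + S(T) f_h / 4)`. -/
def uM (A : Plane → Matrix (Fin 2) (Fin 2) ℝ) (γ f : Plane → ℝ) (u : T.Cell → Plane → ℝ) : T.P0 :=
  fun K => (1 + T.S A K / 4 * T.proj γ K)⁻¹ * (T.proj (u K) K + T.S A K / 4 * T.proj f K)

/-- `p̃_M = -(A_h ∇_NC u + ũ_M b_h) + (f_h - γ_h ũ_M) (x - mid T) / 2`. -/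
def pM (A : Plane → Matrix (Fin 2) (Fin 2) ℝ) (b : Plane → Plane) (γ f : Plane → ℝ)
    (u : T.Cell → Plane → ℝ) : T.Cell → Plane → Plane :=
  fun K x => -(act (T.projMat A K) (T.gradNC u K x) + T.uM A γ f u K • T.proj b K) +
    (T.proj f K - T.proj γ K * T.uM A γ f u K) • ((1 / 2 : ℝ) • (x - mid K.1))

/-- `u ∈ CR¹₀(T)` solves the modified Crouzeix-Raviart problem
`(A_h ∇_NC u + ũ_M b_h, ∇_NC v) + (γ_h ũ_M, v) = (f_h, v)` for all `v ∈ CR¹₀(T)`. -/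
structure SolvesCR (A : Plane → Matrix (Fin 2) (Fin 2) ℝ) (b : Plane → Plane) (γ f : Plane → ℝ)
    (u : T.Cell → Plane → ℝ) : Prop where
  mem : T.IsCR0 u
  eqn : ∀ v, T.IsCR0 v →
    (∫ x in Ω, ⟪T.glue (fun K y => act (T.projMat A K) (T.gradNC u K y) +
        T.uM A γ f u K • T.proj b K) x, T.glue (T.gradNC v) x⟫) +
      ∫ x in Ω, T.const (fun K => T.proj γ K * T.uM A γ f u K) x * T.glue v x =
    ∫ x in Ω, T.const (T.proj f) x * T.glue v x

/-- `(p, w) ∈ RT₀(T) × P₀(T)` solves the mixed scheme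
`(A_h⁻¹ p + w b_h*, q) - (div q, w) = 0` for all `q ∈ RT₀(T)`, with `b_h* = A_h⁻¹ b_h`, and
`(div p, v) + (γ_h w, v) = (f_h, v)` for all `v ∈ P₀(T)`. -/
structure SolvesMixed (A : Plane → Matrix (Fin 2) (Fin 2) ℝ) (b : Plane → Plane)
    (γ f : Plane → ℝ) (p : T.Cell → Plane → Plane) (w : T.P0) : Prop where
  mem : T.IsRT0 p
  eqn₁ : ∀ q, T.IsRT0 q →
    (∫ x in Ω, ⟪T.glue (fun K y => act (T.projMat A K)⁻¹ (p K y) +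
        w K • act (T.projMat A K)⁻¹ (T.proj b K)) x, T.glue q x⟫) -
      ∫ x in Ω, weakDiv Ω (T.glue q) x * T.const w x = 0
  eqn₂ : ∀ v : T.P0,
    (∫ x in Ω, weakDiv Ω (T.glue p) x * T.const v x) +
      ∫ x in Ω, T.const (fun K => T.proj γ K * w K) x * T.const v x =
    ∫ x in Ω, T.const (T.proj f) x * T.const v x

end Triangulation

end

/-!
Everything rests on one pairing. For a piecewise field `q` of the form `c + d x` and a piecewise
`C¹` function `v`, Gauss' theorem on each triangle gives

`∑_K ∫_K (q · ∇v + v div q) = ∑_K ∑_{E ⊆ ∂K} (flux of q through E out of K) (mean of v over E)`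

(`IsTriangle.integral_green`, `Triangulation.sum_integral_green`), since the normal component of `q`
is constant along each edge. Each edge belongs to at most two triangles, which lie on different
sides of it (`Triangulation.area2_mul_neg`). Therefore the right-hand side vanishes if the normal
jumps of `q` vanish and `v` is a Crouzeix-Raviart function (`Triangulation.FluxCancel.sum_eq_zero`).
It vanishes also if `v` is a test function on `Ω`, because boundary edges do not meet
`Ω = int (closure Ω)` (`Triangulation.notMem_of_isBoundaryEdge`); hence fields without normal jumps
are in `H(div, Ω)`, with the piecewise divergence as weak divergence
(`Triangulation.isWeakDiv_glue`). Conversely, orthogonality to all Crouzeix-Raviart functions forces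
the normal jumps to vanish, and orthogonality to all Raviart-Thomas fields forces a piecewise affine
function to be in the Crouzeix-Raviart space; both follow by testing with the basis function of a
single edge (`Triangulation.fluxCancel_of_sum_eq_zero`, `Triangulation.isCR0_of_sum_eq_zero`).

For a piecewise affine `u` with reconstructed pair `(p, w)`, the residual of the modified
Crouzeix-Raviart problem with test function `v` is minus the pairing of `p` and `v`
(`Triangulation.residual_cr`), and the residual of the first mixed equation with test field `q` is
minus the pairing of `q` and `u` (`Triangulation.residual_mixed`). The second identity is where the
weight `S(T)` enters: it is chosen such that `w - S(T) (f_h - γ_h w) / 4` is the value of `u` at the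
centroid. The second mixed equation says that `div p = f_h - γ_h w`, so that every mixed solution
has the form of a reconstructed pair, for exactly one piecewise affine `u`. Coercivity of `A`
enters through the invertibility of its means (`Triangulation.det_projMat_ne_zero`).
-/

noncomputable section

/-! ### Signed areas and integrals over a triangle -/

/-- The planar cross product `u₀ v₁ - u₁ v₀`. -/
def cross (u v : Plane) : ℝ := u 0 * v 1 - u 1 * v 0

lemma inner_eq_coords (u v : Plane) : ⟪u, v⟫ = u 0 * v 0 + u 1 * v 1 := by
  simp [PiLp.inner_apply, Fin.sum_univ_two]; ring

/-- Twice the signed area of the triangle with vertices `a`, `b`, `c`. -/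
def area2 (a b c : Plane) : ℝ := cross (b - a) (c - a)

/-- The affine parametrization of the plane by `ℝ × ℝ` that takes `(0, 0)`, `(1, 0)`, `(0, 1)` to
`a`, `b`, `c`. -/
def toTriangle (a b c : Plane) (p : ℝ × ℝ) : Plane := a + p.1 • (b - a) + p.2 • (c - a)

/-- The reference triangle with vertices `(0, 0)`, `(1, 0)`, `(0, 1)`. It lies in `ℝ × ℝ` rather
than in `Plane` for the sake of Fubini's theorem. -/
def refTriangle : Set (ℝ × ℝ) := {p | 0 ≤ p.1 ∧ 0 ≤ p.2 ∧ p.1 + p.2 ≤ 1}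

lemma convexHull_triple_eq_image (a b c : Plane) :
    convexHull ℝ ({a, b, c} : Set Plane) = toTriangle a b c '' refTriangle := by
  rw [convexHull_insert (by simp), convexHull_pair]
  ext x
  simp only [convexJoin_singleton_left, mem_iUnion, mem_image, refTriangle, mem_ofPred_eq,
    toTriangle, Prod.exists]
  constructor
  · rintro ⟨y, ⟨u, v, hu, hv, huv, rfl⟩, ⟨r, s, hr, hs, hrs, rfl⟩⟩
    refine ⟨s * u, s * v, ⟨by positivity, by positivity, by nlinarith⟩, ?_⟩
    obtain rfl : r = 1 - s := by linarith
    obtain rfl : u = 1 - v := by linarith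
    ext i; simp; ring
  · rintro ⟨s, t, ⟨hs, ht, hst⟩, rfl⟩
    rcases eq_or_lt_of_le (add_nonneg hs ht) with h0 | h0
    · obtain rfl : s = 0 := by linarith
      obtain rfl : t = 0 := by linarith
      exact ⟨b, left_mem_segment ℝ b c, by simpa using left_mem_segment ℝ a b⟩
    · refine ⟨(s / (s + t)) • b + (t / (s + t)) • c, ⟨_, _, by positivity, by positivity,
        by field_simp, rfl⟩, ⟨1 - (s + t), s + t, by linarith, h0.le, by ring, ?_⟩⟩
      ext i; simp; field_simp; ring

/-- Integrals over the reference triangle as iterated integrals. -/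
lemma integral_refTriangle {G : ℝ × ℝ → ℝ} (hG : Continuous G) :
    ∫ p in refTriangle, G p = ∫ t in (0:ℝ)..1, ∫ s in (0:ℝ)..(1 - t), G (s, t) := by
  have hclosed : IsClosed refTriangle :=
    (isClosed_le continuous_const continuous_fst).inter
      ((isClosed_le continuous_const continuous_snd).inter
        (isClosed_le (continuous_fst.add continuous_snd) continuous_const))
  have hsub : refTriangle ⊆ Icc (0:ℝ) 1 ×ˢ Icc (0:ℝ) 1 := by
    rintro ⟨s, t⟩ ⟨h1, h2, h3⟩
    simp only at h1 h2 h3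
    exact ⟨⟨h1, by simp only; linarith⟩, ⟨h2, by simp only; linarith⟩⟩
  have hcomp : IsCompact refTriangle :=
    (isCompact_Icc.prod isCompact_Icc).of_isClosed_subset hclosed hsub
  have hint : Integrable (refTriangle.indicator G) ((volume : Measure ℝ).prod volume) := by
    rw [integrable_indicator_iff hclosed.measurableSet]
    exact hG.continuousOn.integrableOn_compact hcomp
  rw [← integral_indicator hclosed.measurableSet, Measure.volume_eq_prod, integral_prod_symm _ hint,
    intervalIntegral.integral_of_le zero_le_one, ← integral_Icc_eq_integral_Ioc,
    ← integral_indicator measurableSet_Icc]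
  refine integral_congr_ae (Filter.Eventually.of_forall fun t => ?_)
  simp only [indicator_apply, mem_Icc]
  split_ifs with ht
  · rw [intervalIntegral.integral_of_le (by linarith [ht.2]), ← integral_Icc_eq_integral_Ioc,
      ← integral_indicator measurableSet_Icc]
    refine integral_congr_ae (Filter.Eventually.of_forall fun s => ?_)
    simp only [indicator_apply, mem_Icc, refTriangle, mem_ofPred_eq]
    refine if_congr ⟨fun h => ⟨h.1, by linarith [h.2.2]⟩,
      fun h => ⟨h.1, ht.1, by linarith [h.2]⟩⟩ rfl rfl
  · rw [integral_eq_zero_of_ae]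
    refine Filter.Eventually.of_forall fun s => ?_
    have : ¬ (s, t) ∈ refTriangle := by
      rintro ⟨h1, h2, h3⟩
      exact ht ⟨h2, by simp only at h1 h3; linarith⟩
    simp [this]

/-- Change of variables from the reference triangle. -/
lemma integral_triangle {a b c : Plane} (h : area2 a b c ≠ 0) (g : Plane → ℝ) :
    ∫ x in convexHull ℝ ({a, b, c} : Set Plane), g x =
      |area2 a b c| * ∫ p in refTriangle, g (toTriangle a b c p) := by
  let e : ℝ × ℝ ≃ᵐ Plane :=
    (MeasurableEquiv.finTwoArrow (α := ℝ)).symm.trans (MeasurableEquiv.toLp 2 (Fin 2 → ℝ))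
  have he : MeasurePreserving e :=
    (volume_preserving_finTwoArrow ℝ).symm.trans (PiLp.volume_preserving_toLp (Fin 2))
  have he0 : ∀ p, e p 0 = p.1 := fun p => rfl
  have he1 : ∀ p, e p 1 = p.2 := fun p => rfl
  let M : Matrix (Fin 2) (Fin 2) ℝ := !![(b - a) 0, (c - a) 0; (b - a) 1, (c - a) 1]
  let L : Plane →L[ℝ] Plane := LinearMap.toContinuousLinearMap (Matrix.toEuclideanLin M)
  have hdet : L.det = area2 a b c := by
    simp only [L, LinearMap.det_toContinuousLinearMap]
    rw [Matrix.toEuclideanLin_eq_toLin_orthonormal, LinearMap.det_toLin, Matrix.det_fin_two]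
    simp [M, area2, cross]; ring
  have hL : ∀ p, a + L (e p) = toTriangle a b c p := by
    intro p
    ext i
    fin_cases i <;>
      simp [L, M, toTriangle, Matrix.toLpLin_apply, dotProduct, he0, he1,
        Fin.sum_univ_two] <;> ring
  have himg : convexHull ℝ ({a, b, c} : Set Plane) = (fun x => a + L x) '' (e '' refTriangle) := by
    rw [convexHull_triple_eq_image, image_image]
    exact image_congr fun p _ => (hL p).symm
  have hmeas : MeasurableSet refTriangle :=
    (measurableSet_le measurable_const measurable_fst).inter
      ((measurableSet_le measurable_const measurable_snd).inter
        (measurableSet_le (measurable_fst.add measurable_snd) measurable_const))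
  have hinj : Function.Injective (fun x => a + L x) := by
    have hu : IsUnit (LinearMap.det (L : Plane →ₗ[ℝ] Plane)) := by
      rw [isUnit_iff_ne_zero]
      exact fun h0 => h (hdet ▸ h0)
    intro x y hxy
    have := (LinearMap.equivOfIsUnitDet hu).injective
    exact this (by simpa using hxy)
  rw [himg, integral_image_eq_integral_abs_det_fderiv_smul volume
    ((e.measurableSet_image).2 hmeas) (f' := fun _ => L)
    (fun x _ => (L.hasFDerivAt.const_add a).hasFDerivWithinAt) hinj.injOn, hdet,
    ← integral_const_mul, he.setIntegral_image_emb e.measurableEmbedding]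
  simp only [hL, smul_eq_mul]

/-- The mean of `v` over the segment from `y` to `z`. -/
def segMean (v : Plane → ℝ) (y z : Plane) : ℝ := ∫ t in (0:ℝ)..1, v (y + t • (z - y))

lemma segMean_symm (v : Plane → ℝ) (y z : Plane) : segMean v y z = segMean v z y := by
  unfold segMean
  have := intervalIntegral.integral_comp_sub_left (a := 0) (b := 1)
    (fun t => v (z + t • (y - z))) (1 : ℝ)
  simp only [sub_self, sub_zero] at this
  rw [← this]
  refine intervalIntegral.integral_congr fun t _ => ?_
  congr 1
  ext i; simp; ring

lemma area2_rotate (a b c : Plane) : area2 b c a = area2 a b c := by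
  simp [area2, cross]; ring

lemma area2_swap (a b c : Plane) : area2 a c b = -area2 a b c := by
  simp [area2, cross]; ring

/-- Green's formula for the derivative in the direction of an edge. -/
lemma integral_triangle_fderiv {a b c : Plane} (h : area2 a b c ≠ 0) {g : Plane → ℝ}
    (hg : ContDiff ℝ 1 g) :
    ∫ x in convexHull ℝ ({a, b, c} : Set Plane), fderiv ℝ g x (b - a) =
      |area2 a b c| * (segMean g b c - segMean g a c) := by
  have hd : Continuous (fderiv ℝ g) := hg.continuous_fderiv (by norm_num)
  have hc : Continuous (toTriangle a b c) := by unfold toTriangle; fun_prop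
  have hF : Continuous fun p : ℝ × ℝ => fderiv ℝ g (toTriangle a b c p) (b - a) := by fun_prop
  rw [integral_triangle h, integral_refTriangle hF]
  congr 1
  have hgc := hg.continuous
  rw [segMean, segMean, ← intervalIntegral.integral_sub
    (Continuous.intervalIntegrable (by fun_prop) _ _)
    (Continuous.intervalIntegrable (by fun_prop) _ _)]
  refine intervalIntegral.integral_congr fun t _ => ?_
  have hder : ∀ s ∈ uIcc (0:ℝ) (1 - t), HasDerivAt (fun s => g (toTriangle a b c (s, t)))
      (fderiv ℝ g (toTriangle a b c (s, t)) (b - a)) s := by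
    intro s _
    have h1 : HasDerivAt (fun s : ℝ => toTriangle a b c (s, t)) (b - a) s := by
      have := (((hasDerivAt_id s).smul_const (b - a)).const_add a).add_const (t • (c - a))
      simpa [toTriangle] using this
    exact ((hg.differentiable (by norm_num)) _).hasFDerivAt.comp_hasDerivAt s h1
  have hcs : Continuous fun s : ℝ => fderiv ℝ g (toTriangle a b c (s, t)) (b - a) := by
    unfold toTriangle; fun_prop
  refine (intervalIntegral.integral_eq_sub_of_hasDerivAt hder (hcs.intervalIntegrable _ _)).trans ?_
  congr 1
  · congr 1
    ext i; simp [toTriangle]; ring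
  · congr 1
    ext i; simp [toTriangle]

/-- Gauss' theorem on a triangle for the field `v(x) (x - a)`, whose normal component vanishes on
the two edges through the vertex `a`. -/
lemma integral_triangle_vertexField {a b c : Plane} (h : area2 a b c ≠ 0) {v : Plane → ℝ}
    (hv : ContDiff ℝ 1 v) :
    ∫ x in convexHull ℝ ({a, b, c} : Set Plane), (2 * v x + fderiv ℝ v x (x - a)) =
      |area2 a b c| * segMean v b c := by
  -- the barycentric coordinates of the vertices `b` and `c`
  let lb : Plane → ℝ := fun x => cross (x - a) (c - a) / area2 a b c
  let lc : Plane → ℝ := fun x => cross (b - a) (x - a) / area2 a b c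
  let Lb : Plane →L[ℝ] ℝ := (area2 a b c)⁻¹ •
    ((c - a) 1 • EuclideanSpace.proj 0 - (c - a) 0 • EuclideanSpace.proj 1)
  let Lc : Plane →L[ℝ] ℝ := (area2 a b c)⁻¹ •
    ((b - a) 0 • EuclideanSpace.proj 1 - (b - a) 1 • EuclideanSpace.proj 0)
  have elb : lb = fun x => Lb x - Lb a := by
    ext x; simp [lb, Lb, cross]; ring
  have elc : lc = fun x => Lc x - Lc a := by
    ext x; simp [lc, Lc, cross]; ring
  have hlb : ∀ x, HasFDerivAt lb Lb x := fun x => by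
    rw [elb]; exact Lb.hasFDerivAt.sub_const _
  have hlc : ∀ x, HasFDerivAt lc Lc x := fun x => by
    rw [elc]; exact Lc.hasFDerivAt.sub_const _
  have clb : ContDiff ℝ 1 lb := by rw [elb]; fun_prop
  have clc : ContDiff ℝ 1 lc := by rw [elc]; fun_prop
  have hLb : Lb (b - a) = 1 := by
    have h' := h
    simp only [area2, cross, PiLp.sub_apply] at h'
    simp [Lb, area2, cross]; field_simp
  have hLc : Lc (c - a) = 1 := by
    have h' := h
    simp only [area2, cross, PiLp.sub_apply] at h'
    simp [Lc, area2, cross]; field_simp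
  have hrep : ∀ x, lb x • (b - a) + lc x • (c - a) = x - a := by
    intro x
    ext i
    fin_cases i <;> simp [lb, lc, cross] <;> field_simp <;> simp [area2, cross] <;> ring
  have hvd : ∀ x, HasFDerivAt v (fderiv ℝ v x) x := fun x =>
    ((hv.differentiable (by norm_num)) x).hasFDerivAt
  have hsum : ∀ x, 2 * v x + fderiv ℝ v x (x - a) =
      fderiv ℝ (fun y => lb y * v y) x (b - a) + fderiv ℝ (fun y => lc y * v y) x (c - a) := by
    intro x
    rw [((hlb x).fun_mul (hvd x)).fderiv, ((hlc x).fun_mul (hvd x)).fderiv]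
    conv_lhs => rw [← hrep x]
    simp only [map_add, map_smul, add_apply, smul_apply,
      smul_eq_mul, hLb, hLc]
    ring
  have hcomp : IsCompact (convexHull ℝ ({a, b, c} : Set Plane)) :=
    Set.Finite.isCompact_convexHull ℝ (Set.toFinite _)
  have gb : ContDiff ℝ 1 fun y => lb y * v y := clb.mul hv
  have gc : ContDiff ℝ 1 fun y => lc y * v y := clc.mul hv
  have ib : IntegrableOn (fun x => fderiv ℝ (fun y => lb y * v y) x (b - a))
      (convexHull ℝ ({a, b, c} : Set Plane)) := by
    have := gb.continuous_fderiv (by norm_num)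
    exact Continuous.continuousOn (by fun_prop) |>.integrableOn_compact hcomp
  have ic : IntegrableOn (fun x => fderiv ℝ (fun y => lc y * v y) x (c - a))
      (convexHull ℝ ({a, b, c} : Set Plane)) := by
    have := gc.continuous_fderiv (by norm_num)
    exact Continuous.continuousOn (by fun_prop) |>.integrableOn_compact hcomp
  have h2 := integral_triangle_fderiv (a := a) (b := c) (c := b)
    (by rw [area2_swap]; exact neg_ne_zero.2 h) gc
  rw [area2_swap, abs_neg, pair_comm c b] at h2
  simp only [hsum]
  rw [integral_add ib ic, integral_triangle_fderiv h gb, h2, ← mul_add]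
  congr 1
  have hz1 : segMean (fun y => lb y * v y) a c = 0 := by
    unfold segMean
    refine (intervalIntegral.integral_congr (g := fun _ => 0) fun t _ => ?_).trans (by simp)
    simp [lb, cross]; left; left; ring
  have hz2 : segMean (fun y => lc y * v y) a b = 0 := by
    unfold segMean
    refine (intervalIntegral.integral_congr (g := fun _ => 0) fun t _ => ?_).trans (by simp)
    simp [lc, cross]; left; left; ring
  have hvc := hv.continuous
  have clb' := clb.continuous
  have clc' := clc.continuous
  rw [hz1, hz2, sub_zero, sub_zero, segMean_symm _ c b]
  unfold segMean
  rw [← intervalIntegral.integral_add (Continuous.intervalIntegrable (by fun_prop) _ _)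
    (Continuous.intervalIntegrable (by fun_prop) _ _)]
  refine intervalIntegral.integral_congr fun t _ => ?_
  have h1 : lb (b + t • (c - b)) + lc (b + t • (c - b)) = 1 := by
    simp only [lb, lc, cross]
    field_simp
    simp [area2, cross]; ring
  simp only
  rw [← add_mul, h1, one_mul]

lemma segMean_affine (w : Plane) (k : ℝ) (y z : Plane) :
    segMean (fun x => ⟪w, x⟫ + k) y z = ⟪w, (2⁻¹ : ℝ) • (y + z)⟫ + k := by
  unfold segMean
  have : ∀ t : ℝ, ⟪w, y + t • (z - y)⟫ + k = (⟪w, y⟫ + k) + t * ⟪w, z - y⟫ := by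
    intro t; rw [inner_add_right, inner_smul_right]; ring
  simp only [this]
  rw [intervalIntegral.integral_add (by simp) (Continuous.intervalIntegrable (by fun_prop) _ _),
    intervalIntegral.integral_mul_const]
  simp [inner_add_right, inner_smul_right, inner_sub_right]
  ring

lemma fderiv_affine (w : Plane) (k : ℝ) (x y : Plane) :
    fderiv ℝ (fun x => ⟪w, x⟫ + k) x y = ⟪w, y⟫ := by
  have : HasFDerivAt (fun x => ⟪w, x⟫ + k) (innerSL ℝ w) x :=
    (innerSL ℝ w).hasFDerivAt.add_const k
  rw [this.fderiv]; simp

lemma gradient_affine (w : Plane) (k : ℝ) (x : Plane) :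
    gradient (fun x => ⟪w, x⟫ + k) x = w := by
  have : HasFDerivAt (fun x => ⟪w, x⟫ + k) (innerSL ℝ w) x :=
    (innerSL ℝ w).hasFDerivAt.add_const k
  refine HasGradientAt.gradient ?_
  rw [hasGradientAt_iff_hasFDerivAt]
  exact this

lemma volume_triangle {a b c : Plane} (h : area2 a b c ≠ 0) :
    volume.real (convexHull ℝ ({a, b, c} : Set Plane)) = |area2 a b c| / 2 := by
  have := integral_triangle_vertexField h (v := fun _ => 1) contDiff_const
  simp [segMean] at this
  linarith

/-- The integral of an affine function over a triangle. -/
lemma integral_triangle_affine {a b c : Plane} (h : area2 a b c ≠ 0) (w : Plane) (k : ℝ) :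
    ∫ x in convexHull ℝ ({a, b, c} : Set Plane), (⟪w, x⟫ + k) =
      |area2 a b c| / 2 * (⟪w, (3⁻¹ : ℝ) • (a + b + c)⟫ + k) := by
  have h1 := integral_triangle_vertexField h (v := fun x => ⟪w, x⟫ + k)
    ((contDiff_const.inner ℝ contDiff_id).add contDiff_const)
  have hcomp : IsCompact (convexHull ℝ ({a, b, c} : Set Plane)) :=
    Set.Finite.isCompact_convexHull ℝ (Set.toFinite _)
  have hi : IntegrableOn (fun x => ⟪w, x⟫ + k) (convexHull ℝ ({a, b, c} : Set Plane)) :=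
    Continuous.continuousOn (by fun_prop) |>.integrableOn_compact hcomp
  simp only [fderiv_affine, segMean_affine] at h1
  have h2 : ∀ x, 2 * (⟪w, x⟫ + k) + ⟪w, x - a⟫ = 3 * (⟪w, x⟫ + k) - (⟪w, a⟫ + k) := by
    intro x; rw [inner_sub_right]; ring
  simp only [h2] at h1
  have hfin : volume (convexHull ℝ ({a, b, c} : Set Plane)) ≠ ⊤ := hcomp.measure_lt_top.ne
  rw [integral_sub (hi.const_mul 3) (integrableOn_const hfin), integral_const_mul,
    setIntegral_const, volume_triangle h] at h1
  simp only [inner_smul_right, inner_add_right, smul_eq_mul] at h1 ⊢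
  linarith

/-! ### Edge functionals and Gauss' theorem for Raviart-Thomas fields -/

/-- The mean of `v` over the edge `E`, symmetric in the two end points of `E`. -/
def edgeMean (v : Plane → ℝ) (E : Finset Plane) : ℝ :=
  (∑ p ∈ E.offDiag, segMean v p.1 p.2) / 2

/-- The flux of `q` through the edge `E` out of the triangle with third vertex `z`, for a field `q`
with constant normal component along `E`: with `E = {y, y'}` traversed counterclockwise around the
triangle, this is `cross (q (mid E)) (y' - y)`. Summing over both orders of the end points and
correcting the orientation by the sign avoids the choice of an order. -/
def outwardFlux (q : Plane → Plane) (z : Plane) (E : Finset Plane) : ℝ :=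
  (∑ p ∈ E.offDiag,
    (SignType.sign (area2 z p.1 p.2) : ℝ) * cross (q (mid E)) (p.2 - p.1)) / 2

lemma offDiag_pair {y z : Plane} (h : y ≠ z) :
    ({y, z} : Finset Plane).offDiag = {(y, z), (z, y)} := by
  ext ⟨p, q⟩
  simp only [Finset.mem_offDiag, Finset.mem_insert, Finset.mem_singleton, Prod.mk.injEq]
  constructor
  · rintro ⟨rfl | rfl, rfl | rfl, h3⟩ <;> simp_all
  · rintro (⟨rfl, rfl⟩ | ⟨rfl, rfl⟩) <;> simp_all [Ne.symm h]

lemma mid_pair {y z : Plane} (h : y ≠ z) :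
    mid ({y, z} : Finset Plane) = (2⁻¹ : ℝ) • (y + z) := by
  simp [mid, Finset.card_pair h, Finset.sum_pair h]

lemma mid_triple {a b c : Plane} (hab : a ≠ b) (hac : a ≠ c) (hbc : b ≠ c) :
    mid ({a, b, c} : Finset Plane) = (3⁻¹ : ℝ) • (a + b + c) := by
  have h1 : a ∉ ({b, c} : Finset Plane) := by simp [hab, hac]
  simp [mid, Finset.sum_insert h1, Finset.card_insert_of_notMem h1, Finset.card_pair hbc,
    Finset.sum_pair hbc]
  norm_num [add_assoc]

lemma edgeMean_pair (v : Plane → ℝ) {y z : Plane} (h : y ≠ z) :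
    edgeMean v {y, z} = segMean v y z := by
  rw [edgeMean, offDiag_pair h, Finset.sum_pair (by simp [h]), segMean_symm v z y]
  ring

lemma outwardFlux_pair (q : Plane → Plane) (a : Plane) {y z : Plane} (h : y ≠ z) :
    outwardFlux q a {y, z} =
      (SignType.sign (area2 a y z) : ℝ) * cross (q ((2⁻¹ : ℝ) • (y + z))) (z - y) := by
  rw [outwardFlux, offDiag_pair h, Finset.sum_pair (by simp [h]), mid_pair h]
  simp only [area2_swap a y z, Left.sign_neg, SignType.coe_neg]
  simp [cross]; ring

lemma sum_erase_triple {a b c : Plane} (hab : a ≠ b) (hac : a ≠ c) (hbc : b ≠ c)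
    (F : Plane → Finset Plane → ℝ) :
    ∑ z ∈ ({a, b, c} : Finset Plane), F z (({a, b, c} : Finset Plane).erase z) =
      F a {b, c} + F b {c, a} + F c {a, b} := by
  have h1 : a ∉ ({b, c} : Finset Plane) := by simp [hab, hac]
  have ea : ({a, b, c} : Finset Plane).erase a = {b, c} := by
    ext x; simp; grind
  have eb : ({a, b, c} : Finset Plane).erase b = {c, a} := by
    ext x; simp; grind
  have ec : ({a, b, c} : Finset Plane).erase c = {a, b} := by
    ext x; simp; grind
  rw [Finset.sum_insert h1, Finset.sum_pair hbc, ea, eb, ec, add_assoc]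

/-- A set of three affinely independent points, the vertices of a nondegenerate triangle. -/
structure IsTriangle (K : Finset Plane) : Prop where
  card_eq : K.card = 3
  affineIndependent : AffineIndependent ℝ (fun x : K => (x : Plane))

lemma collinear_of_area2_eq_zero {a b c : Plane} (hab : a ≠ b) (h : area2 a b c = 0) :
    Collinear ℝ ({a, b, c} : Set Plane) := by
  rw [collinear_iff_of_mem (p₀ := a) (by simp)]
  refine ⟨b - a, ?_⟩
  have hc : ∃ r : ℝ, c = r • (b - a) + a := by
    simp only [area2, cross, PiLp.sub_apply] at h
    by_cases h0 : b 0 - a 0 = 0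
    · have h1 : b 1 - a 1 ≠ 0 := by
        intro h1
        apply hab
        ext i
        fin_cases i <;> simp <;> linarith
      refine ⟨(c 1 - a 1) / (b 1 - a 1), ?_⟩
      rw [h0] at h
      have h2 : c 0 - a 0 = 0 := by
        have : (b 1 - a 1) * (c 0 - a 0) = 0 := by linarith
        exact (mul_eq_zero.1 this).resolve_left h1
      ext i
      fin_cases i
      · simp [h0]; linarith
      · simp; field_simp; ring
    · refine ⟨(c 0 - a 0) / (b 0 - a 0), ?_⟩
      ext i
      fin_cases i
      · simp; field_simp; ring
      · simp; field_simp; linarith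
  obtain ⟨r, hr⟩ := hc
  intro p hp
  simp only [mem_insert_iff, mem_singleton_iff] at hp
  rcases hp with rfl | rfl | rfl
  · exact ⟨0, by simp⟩
  · exact ⟨1, by simp⟩
  · exact ⟨r, by simpa using hr⟩

lemma IsTriangle.area2_ne_zero {a b c : Plane} (hK : IsTriangle {a, b, c}) :
    area2 a b c ≠ 0 := by
  intro h
  have hcard := hK.card_eq
  have hab : a ≠ b := by
    rintro rfl
    have := Finset.card_le_two (a := a) (b := c)
    simp at hcard; omega
  have h1 := collinear_iff_finrank_le_one.1 (collinear_of_area2_eq_zero hab h)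
  have h2 := hK.affineIndependent.finrank_vectorSpan (n := 2) (by simpa using hcard)
  have h3 : Set.range (fun x : ({a, b, c} : Finset Plane) => (x : Plane)) = {a, b, c} := by
    ext x; simp
  rw [h3] at h2
  omega

lemma IsTriangle.exists_eq {K : Finset Plane} (hK : IsTriangle K) :
    ∃ a b c, a ≠ b ∧ a ≠ c ∧ b ≠ c ∧ K = {a, b, c} ∧ area2 a b c ≠ 0 := by
  obtain ⟨a, b, c, hab, hac, hbc, rfl⟩ := Finset.card_eq_three.1 hK.card_eq
  exact ⟨a, b, c, hab, hac, hbc, rfl, hK.area2_ne_zero⟩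

lemma isCompact_hull (K : Finset Plane) : IsCompact (hull K) :=
  Set.Finite.isCompact_convexHull ℝ K.finite_toSet

lemma integral_interior_hull (K : Finset Plane) (g : Plane → ℝ) :
    ∫ x in interior (hull K), g x = ∫ x in hull K, g x :=
  setIntegral_congr_set (interior_ae_eq_of_null_frontier
    ((convex_convexHull ℝ _).addHaar_frontier volume))

lemma sign_mul_eq_abs (r : ℝ) : (SignType.sign r : ℝ) * r = |r| := by
  rcases lt_trichotomy r 0 with h | rfl | h
  · simp [sign_neg h, abs_of_neg h]
  · simp
  · simp [sign_pos h, abs_of_pos h]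

/-- Gauss' theorem for the product of a Raviart-Thomas field and a `C¹` function on a triangle. The
field is the combination of the three fields `x - z`, with `z` running through the vertices, whose
coefficients are proportional to the fluxes through the opposite edges. -/
lemma IsTriangle.integral_green {K : Finset Plane} (hK : IsTriangle K) {q : Plane → Plane}
    {w : Plane} {d : ℝ} (hq : ∀ x, q x = w + d • x) {v : Plane → ℝ} (hv : ContDiff ℝ 1 v) :
    ∫ x in hull K, (⟪q x, gradient v x⟫ + 2 * d * v x) =
      ∑ z ∈ K, outwardFlux q z (K.erase z) * edgeMean v (K.erase z) := by
  obtain ⟨a, b, c, hab, hac, hbc, rfl, h⟩ := hK.exists_eq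
  rw [sum_erase_triple hab hac hbc (fun z E => outwardFlux q z E * edgeMean v E)]
  simp only [edgeMean_pair v hab, edgeMean_pair v hbc, edgeMean_pair v hac.symm,
    outwardFlux_pair q _ hab, outwardFlux_pair q _ hbc, outwardFlux_pair q _ hac.symm]
  have r1 : area2 b c a = area2 a b c := area2_rotate a b c
  have r2 : area2 c a b = area2 a b c := by rw [area2_rotate, area2_rotate]
  rw [r1, r2]
  set D := area2 a b c with hD
  set fa := cross (q ((2⁻¹ : ℝ) • (b + c))) (c - b) with hfa
  set fb := cross (q ((2⁻¹ : ℝ) • (c + a))) (a - c) with hfb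
  set fc := cross (q ((2⁻¹ : ℝ) • (a + b))) (b - a) with hfc
  have hrep : ∀ x, D • q x = fa • (x - a) + fb • (x - b) + fc • (x - c) := by
    intro x
    rw [hD, hfa, hfb, hfc]
    simp only [hq]
    ext i
    fin_cases i <;> simp [area2, cross] <;> ring
  have hsum : D * d = fa + fb + fc := by
    rw [hD, hfa, hfb, hfc]
    simp only [hq]
    simp [area2, cross]; ring
  have hgrad : ∀ x y, ⟪y, gradient v x⟫ = fderiv ℝ v x y := by
    intro x y
    rw [real_inner_comm, gradient, InnerProductSpace.toDual_symm_apply]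
  have hint : ∀ x, ⟪q x, gradient v x⟫ + 2 * d * v x =
      D⁻¹ * (fa * (2 * v x + fderiv ℝ v x (x - a)) + fb * (2 * v x + fderiv ℝ v x (x - b)) +
        fc * (2 * v x + fderiv ℝ v x (x - c))) := by
    intro x
    have e1 : D * ⟪q x, gradient v x⟫ = fa * fderiv ℝ v x (x - a) + fb * fderiv ℝ v x (x - b) +
        fc * fderiv ℝ v x (x - c) := by
      rw [hgrad, ← smul_eq_mul, ← map_smul, hrep, map_add, map_add, map_smul, map_smul, map_smul]
      simp only [smul_eq_mul]
    field_simp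
    linear_combination e1 + 2 * v x * hsum
  have hd : Continuous (fderiv ℝ v) := hv.continuous_fderiv (by norm_num)
  have hvc := hv.continuous
  have hi : ∀ z, IntegrableOn (fun x => 2 * v x + fderiv ℝ v x (x - z))
      (hull {a, b, c}) := fun z =>
    (Continuous.continuousOn (by fun_prop)).integrableOn_compact (isCompact_hull _)
  have ha : ∫ x in hull {a, b, c}, (2 * v x + fderiv ℝ v x (x - a)) = |D| * segMean v b c := by
    have := integral_triangle_vertexField h hv
    simpa [hull] using this
  have hb : ∫ x in hull {a, b, c}, (2 * v x + fderiv ℝ v x (x - b)) = |D| * segMean v c a := by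
    have := integral_triangle_vertexField (a := b) (b := c) (c := a) (r1 ▸ h) hv
    rw [r1] at this
    have e : ({b, c, a} : Set Plane) = {a, b, c} := by ext x; simp; tauto
    rw [e] at this
    simpa [hull] using this
  have hc : ∫ x in hull {a, b, c}, (2 * v x + fderiv ℝ v x (x - c)) = |D| * segMean v a b := by
    have := integral_triangle_vertexField (a := c) (b := a) (c := b) (r2 ▸ h) hv
    rw [r2] at this
    have e : ({c, a, b} : Set Plane) = {a, b, c} := by ext x; simp; tauto
    rw [e] at this
    simpa [hull] using this
  simp only [hint]
  rw [integral_const_mul, integral_add, integral_add, integral_const_mul, integral_const_mul,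
    integral_const_mul, ha, hb, hc, ← sign_mul_eq_abs]
  · field_simp
  · exact (hi a).const_mul _
  · exact (hi b).const_mul _
  · exact ((hi a).const_mul _).add ((hi b).const_mul _)
  · exact (hi c).const_mul _

lemma IsTriangle.volume_pos {K : Finset Plane} (hK : IsTriangle K) :
    0 < volume.real (hull K) := by
  obtain ⟨a, b, c, hab, hac, hbc, rfl, h⟩ := hK.exists_eq
  have := volume_triangle h
  have h2 : volume.real (hull {a, b, c}) = |area2 a b c| / 2 := by simpa [hull] using this
  rw [h2]
  positivity

lemma IsTriangle.integral_affine {K : Finset Plane} (hK : IsTriangle K) (w : Plane) (k : ℝ) :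
    ∫ x in hull K, (⟪w, x⟫ + k) = volume.real (hull K) * (⟪w, mid K⟫ + k) := by
  obtain ⟨a, b, c, hab, hac, hbc, rfl, h⟩ := hK.exists_eq
  have h1 := integral_triangle_affine h w k
  have h2 := volume_triangle h
  rw [← h2, ← mid_triple hab hac hbc] at h1
  simpa [hull] using h1

lemma edgeMean_affine {E : Finset Plane} (hE : E.card = 2) (w : Plane) (k : ℝ) :
    edgeMean (fun x => ⟪w, x⟫ + k) E = ⟪w, mid E⟫ + k := by
  obtain ⟨y, z, h, rfl⟩ := Finset.card_eq_two.1 hE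
  rw [edgeMean_pair _ h, segMean_affine, mid_pair h]

/-! ### Barycentric coordinates by areas -/

/-- A point as an affine combination of the vertices of a triangle. -/
lemma area2_smul_eq (a b c x : Plane) :
    area2 a b c • x = area2 x b c • a + area2 a x c • b + area2 a b x • c := by
  ext i
  fin_cases i <;> simp [area2, cross] <;> ring

lemma area2_sum (a b c x : Plane) :
    area2 x b c + area2 a x c + area2 a b x = area2 a b c := by
  simp [area2, cross]; ring

lemma mem_convexHull_triple {a b c x : Plane} :
    x ∈ convexHull ℝ ({a, b, c} : Set Plane) ↔ ∃ r s t : ℝ, 0 ≤ r ∧ 0 ≤ s ∧ 0 ≤ t ∧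
      r + s + t = 1 ∧ x = r • a + s • b + t • c := by
  rw [convexHull_triple_eq_image]
  constructor
  · rintro ⟨⟨s, t⟩, ⟨hs, ht, hst⟩, rfl⟩
    refine ⟨1 - s - t, s, t, by simp only at hst; linarith, hs, ht, by ring, ?_⟩
    ext i; simp [toTriangle]; ring
  · rintro ⟨r, s, t, hr, hs, ht, h, rfl⟩
    refine ⟨(s, t), ⟨hs, ht, by simp only; linarith⟩, ?_⟩
    obtain rfl : r = 1 - s - t := by linarith
    ext i; simp [toTriangle]; ring

lemma area2_mul_nonneg_of_mem {a b c x : Plane} (hx : x ∈ convexHull ℝ ({a, b, c} : Set Plane)) :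
    0 ≤ area2 x b c * area2 a b c := by
  obtain ⟨r, s, t, hr, hs, ht, h, rfl⟩ := mem_convexHull_triple.1 hx
  obtain rfl : s = 1 - r - t := by linarith
  have : area2 (r • a + (1 - r - t) • b + t • c) b c = r * area2 a b c := by
    simp [area2, cross]; ring
  rw [this, mul_assoc]
  exact mul_nonneg hr (mul_self_nonneg _)

lemma area2_eq_zero_of_mem_segment {x y z : Plane}
    (hx : x ∈ convexHull ℝ ({y, z} : Set Plane)) : area2 x y z = 0 := by
  rw [convexHull_pair] at hx
  obtain ⟨r, s, hr, hs, h, rfl⟩ := hx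
  obtain rfl : r = 1 - s := by linarith
  simp [area2, cross]; ring

lemma IsTriangle.exists_erase_eq {K : Finset Plane} (hK : IsTriangle K) {z : Plane} (hz : z ∈ K) :
    ∃ y y', y ≠ y' ∧ K.erase z = {y, y'} ∧ K = {z, y, y'} ∧ area2 z y y' ≠ 0 := by
  have h2 : (K.erase z).card = 2 := by rw [Finset.card_erase_of_mem hz, hK.card_eq]
  obtain ⟨y, y', h, he⟩ := Finset.card_eq_two.1 h2
  have hKe : K = {z, y, y'} := by rw [← he, Finset.insert_erase hz]
  refine ⟨y, y', h, he, hKe, ?_⟩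
  subst hKe
  exact hK.area2_ne_zero

namespace Triangulation

variable {Ω : Set Plane} (T : Triangulation Ω)

/-! ### Edges of a regular triangulation -/

lemma isTriangle (K : T.Cell) : IsTriangle K.1 :=
  ⟨T.card_eq K.1 K.2, T.affineIndependent K.1 K.2⟩

variable {T}

lemma isEdgeOf_iff {E : Finset Plane} {K : T.Cell} :
    T.IsEdgeOf E K ↔ ∃ z ∈ K.1, E = K.1.erase z := by
  constructor
  · rintro ⟨hc, hs⟩
    obtain ⟨z, hz, h⟩ := Finset.exists_eq_insert_iff.2
      ⟨hs, by rw [hc, (T.isTriangle K).card_eq]⟩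
    exact ⟨z, by rw [← h]; simp, by rw [← h, Finset.erase_insert hz]⟩
  · rintro ⟨z, hz, rfl⟩
    exact ⟨by rw [Finset.card_erase_of_mem hz, (T.isTriangle K).card_eq], Finset.erase_subset _ _⟩

lemma isEdgeOf_erase (K : T.Cell) {z : Plane} (hz : z ∈ K.1) : T.IsEdgeOf (K.1.erase z) K :=
  isEdgeOf_iff.2 ⟨z, hz, rfl⟩

/-- Two triangles with a common edge lie on different sides of it. -/
lemma area2_mul_neg {K L : T.Cell} (hKL : K ≠ L) {z z' y y' : Plane}
    (hK : K.1 = {z, y, y'}) (hL : L.1 = {z', y, y'}) : area2 z y y' * area2 z' y y' < 0 := by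
  have hD : area2 z y y' ≠ 0 := (hK ▸ T.isTriangle K).area2_ne_zero
  have hD' : area2 z' y y' ≠ 0 := (hL ▸ T.isTriangle L).area2_ne_zero
  by_contra hcon
  have hpos : 0 < area2 z y y' * area2 z' y y' :=
    lt_of_le_of_ne (not_lt.1 hcon) (mul_ne_zero hD hD').symm
  have hinter : ((K.1 : Set Plane) ∩ (L.1 : Set Plane)) = {y, y'} := by
    have hzL : z ∉ L.1 := by
      rw [hL]
      simp only [Finset.mem_insert, Finset.mem_singleton, not_or]
      refine ⟨?_, ?_, ?_⟩
      · rintro rfl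
        exact hKL (Subtype.ext (hK.trans hL.symm))
      · rintro rfl
        exact hD (by simp [area2, cross])
      · rintro rfl
        exact hD (by simp [area2, cross])
    ext x
    simp only [mem_inter_iff, Finset.mem_coe, mem_insert_iff, mem_singleton_iff]
    constructor
    · rintro ⟨h1, h2⟩
      rw [hK] at h1
      simp only [Finset.mem_insert, Finset.mem_singleton] at h1
      rcases h1 with rfl | h1
      · exact absurd h2 hzL
      · exact h1
    · rw [hK, hL]
      rintro (rfl | rfl) <;> simp
  -- barycentric coordinates of `z` in the second triangle
  set r := area2 z y y' / area2 z' y y' with hr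
  set α := area2 z' z y' / area2 z' y y' with hα
  set β := area2 z' y z / area2 z' y y' with hβ
  have hr0 : 0 < r := by
    rw [hr, div_eq_mul_inv, ← mul_pos_iff_of_pos_right (mul_self_pos.2 hD')]
    field_simp
    linarith
  have hz : z = r • z' + α • y + β • y' := by
    have := area2_smul_eq z' y y' z
    have h2 : z = (area2 z' y y')⁻¹ • (area2 z' y y' • z) := (inv_smul_smul₀ hD' z).symm
    rw [this] at h2
    rw [hr, hα, hβ]
    conv_lhs => rw [h2]
    simp only [smul_add, smul_smul, div_eq_inv_mul]
  have hsum : r + α + β = 1 := by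
    rw [hr, hα, hβ, ← add_div, ← add_div, area2_sum, div_self hD']
  -- a point of both triangles, close to the midpoint of the common edge but not on it
  set ε := 1 / (1 + 2 * |α| + 2 * |β|) with hε
  have hden : 0 < 1 + 2 * |α| + 2 * |β| := by positivity
  have hε0 : 0 < ε := by positivity
  have hεd : ε * (1 + 2 * |α| + 2 * |β|) = 1 := by rw [hε]; field_simp
  have h1 : 0 ≤ ε * |α| := by positivity
  have h2 : 0 ≤ ε * |β| := by positivity
  have h3 : -(ε * |α|) ≤ ε * α := by
    rw [← mul_neg]; exact mul_le_mul_of_nonneg_left (neg_abs_le α) hε0.le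
  have h4 : -(ε * |β|) ≤ ε * β := by
    rw [← mul_neg]; exact mul_le_mul_of_nonneg_left (neg_abs_le β) hε0.le
  set p := ε • z + ((1 - ε) / 2) • y + ((1 - ε) / 2) • y' with hp
  have hpK : p ∈ hull K.1 := by
    rw [hull, hK]
    push_cast
    exact mem_convexHull_triple.2 ⟨_, _, _, hε0.le, by linarith, by linarith, by ring, hp⟩
  have hpL : p ∈ hull L.1 := by
    rw [hull, hL]
    push_cast
    refine mem_convexHull_triple.2 ⟨ε * r, (1 - ε) / 2 + ε * α, (1 - ε) / 2 + ε * β,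
      by positivity, by linarith, by linarith, ?_, ?_⟩
    · linear_combination ε * hsum
    · rw [hp]
      conv_lhs => rw [hz]
      module
  have hpE : p ∈ convexHull ℝ ({y, y'} : Set Plane) := by
    rw [← hinter, ← T.conforming K.1 K.2 L.1 L.2]
    exact ⟨hpK, hpL⟩
  have hz0 := area2_eq_zero_of_mem_segment hpE
  have : area2 p y y' = ε * area2 z y y' := by
    rw [hp]; simp [area2, cross]; ring
  rw [this] at hz0
  exact (mul_ne_zero hε0.ne' hD) hz0

/-- No edge belongs to three triangles. -/
lemma eq_or_eq_of_isEdgeOf {E : Finset Plane} {K L M : T.Cell} (hKL : K ≠ L)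
    (hK : T.IsEdgeOf E K) (hL : T.IsEdgeOf E L) (hM : T.IsEdgeOf E M) : M = K ∨ M = L := by
  by_contra hcon
  push Not at hcon
  obtain ⟨y, y', hy, rfl⟩ := Finset.card_eq_two.1 hK.1
  have key : ∀ N : T.Cell, T.IsEdgeOf {y, y'} N → ∃ z, N.1 = {z, y, y'} := by
    intro N hN
    obtain ⟨z, hz, h⟩ := isEdgeOf_iff.1 hN
    exact ⟨z, by rw [h, Finset.insert_erase hz]⟩
  obtain ⟨k, hk⟩ := key K hK
  obtain ⟨l, hl⟩ := key L hL
  obtain ⟨m, hm⟩ := key M hM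
  have h1 := area2_mul_neg hKL hk hl
  have h2 := area2_mul_neg hcon.1 hm hk
  have h3 := area2_mul_neg hcon.2 hm hl
  have h4 := mul_pos_of_neg_of_neg h1 h2
  have h5 := mul_neg_of_pos_of_neg h4 h3
  have h6 := sq_nonneg (area2 k y y' * area2 l y y' * area2 m y y')
  linarith [h6, h5, show area2 k y y' * area2 l y y' * (area2 m y y' * area2 k y y') *
    (area2 m y y' * area2 l y y') = (area2 k y y' * area2 l y y' * area2 m y y') ^ 2 by ring]

/-- A sum over all pairs of a triangle and one of its edges vanishes if the two contributions of
each interior edge cancel and each boundary edge contributes nothing. The edges of a triangle are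
indexed by the opposite vertices. -/
lemma sum_edges_eq_zero (G : T.Cell → Plane → ℝ)
    (hint : ∀ K L : T.Cell, K ≠ L → ∀ z ∈ K.1, ∀ z' ∈ L.1, K.1.erase z = L.1.erase z' →
      G K z + G L z' = 0)
    (hbdry : ∀ K : T.Cell, ∀ z ∈ K.1, T.IsBoundaryEdge (K.1.erase z) → G K z = 0) :
    ∑ K : T.Cell, ∑ z ∈ K.1, G K z = 0 := by
  classical
  rw [Finset.sum_sigma']
  have hinj : ∀ (K : T.Cell) (z z' : Plane), z ∈ K.1 → z' ∈ K.1 →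
      K.1.erase z = K.1.erase z' → z = z' := fun K z z' hz hz' h =>
    (Finset.erase_inj (s := K.1) hz).1 h
  let P : (Σ _ : T.Cell, Plane) → (Σ _ : T.Cell, Plane) → Prop := fun p p' =>
    p'.2 ∈ p'.1.1 ∧ p'.1 ≠ p.1 ∧ p.1.1.erase p.2 = p'.1.1.erase p'.2
  let g : (Σ _ : T.Cell, Plane) → (Σ _ : T.Cell, Plane) := fun p =>
    if h : ∃ p', P p p' then h.choose else p
  have hg : ∀ p p', p.2 ∈ p.1.1 → P p p' → g p = p' := by
    intro p p' hp h
    have hex : ∃ p', P p p' := ⟨p', h⟩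
    have hgp : g p = hex.choose := dif_pos hex
    rw [hgp]
    have hs : P p hex.choose := hex.choose_spec
    set p'' := hex.choose
    obtain ⟨K, z⟩ := p
    obtain ⟨K', z'⟩ := p'
    obtain ⟨K'', z''⟩ := p''
    obtain ⟨a1, a2, a3⟩ := h
    obtain ⟨b1, b2, b3⟩ := hs
    simp only at *
    have e1 : T.IsEdgeOf (K.1.erase z) K := isEdgeOf_erase K hp
    have e2 : T.IsEdgeOf (K.1.erase z) K' := by rw [a3]; exact isEdgeOf_erase K' a1
    have e3 : T.IsEdgeOf (K.1.erase z) K'' := by rw [b3]; exact isEdgeOf_erase K'' b1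
    obtain rfl : K'' = K' := (eq_or_eq_of_isEdgeOf a2.symm e1 e2 e3).resolve_left b2
    rw [hinj K'' z'' z' b1 a1 (b3.symm.trans a3)]
  have hzero : ∀ p : (Σ _ : T.Cell, Plane), p.2 ∈ p.1.1 → (¬ ∃ p', P p p') → G p.1 p.2 = 0 := by
    intro p hp h
    refine hbdry _ _ hp ⟨p.1, isEdgeOf_erase _ hp, fun L hL => ?_⟩
    by_contra hne
    obtain ⟨z', hz', he⟩ := isEdgeOf_iff.1 hL
    exact h ⟨⟨L, z'⟩, hz', hne, he⟩
  have hmem : ∀ p : (Σ _ : T.Cell, Plane),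
      p ∈ (Finset.univ.sigma fun K : T.Cell => K.1) ↔ p.2 ∈ p.1.1 := by
    intro p; simp
  refine Finset.sum_involution (fun p _ => g p) ?_ ?_ ?_ ?_
  · intro p hp
    rw [hmem] at hp
    by_cases hex : ∃ p', P p p'
    · obtain ⟨p', h⟩ := hex
      rw [hg p p' hp h]
      exact hint _ _ h.2.1.symm _ hp _ h.1 h.2.2
    · have : g p = p := dif_neg hex
      rw [this, hzero p hp hex, add_zero]
  · intro p hp hne
    rw [hmem] at hp
    by_cases hex : ∃ p', P p p'
    · obtain ⟨p', h⟩ := hex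
      rw [hg p p' hp h]
      exact fun he => h.2.1 (by rw [he])
    · exact absurd (hzero p hp hex) hne
  · intro p hp
    rw [hmem] at hp ⊢
    by_cases hex : ∃ p', P p p'
    · obtain ⟨p', h⟩ := hex
      rw [hg p p' hp h]
      exact h.1
    · have : g p = p := dif_neg hex
      rw [this]; exact hp
  · intro p hp
    rw [hmem] at hp
    by_cases hex : ∃ p', P p p'
    · obtain ⟨p', h⟩ := hex
      simp only [hg p p' hp h]
      exact hg p' p h.1 ⟨hp, h.2.1.symm, h.2.2.symm⟩
    · have : g p = p := dif_neg hex
      simp only [this]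

/-- Since `Ω` is the interior of its closure, a boundary edge without its end points does not meet
`Ω`. -/
lemma notMem_of_isBoundaryEdge (hΩreg : interior (closure Ω) = Ω) {K : T.Cell} {z y y' : Plane}
    (hK : K.1 = {z, y, y'}) (hyy : y ≠ y') (hE : T.IsBoundaryEdge {y, y'}) {t : ℝ}
    (ht0 : 0 < t) (ht1 : t < 1) : y + t • (y' - y) ∉ Ω := by
  intro hx
  have hD : area2 z y y' ≠ 0 := (hK ▸ T.isTriangle K).area2_ne_zero
  set x := y + t • (y' - y) with hxdef
  have hopen : IsOpen Ω := hΩreg ▸ isOpen_interior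
  -- points close to `x` on the other side of the edge
  let c : ℝ → Plane := fun ε => x + ε • (x - z)
  have hc : Continuous c := by fun_prop
  have hc0 : c 0 = x := by simp [c]
  have harea : ∀ ε, area2 (c ε) y y' = -ε * area2 z y y' := by
    intro ε; simp [c, hxdef, area2, cross]; ring
  have hnear : ∀ᶠ ε in nhds (0:ℝ), c ε ∈ Ω ∧ ∀ L : T.Cell, c ε ∈ hull L.1 → x ∈ hull L.1 := by
    refine Filter.Eventually.and ?_ ?_
    · exact hc.continuousAt.eventually_mem (hopen.mem_nhds (by rw [hc0]; exact hx))
    · rw [Filter.eventually_all]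
      intro L
      by_cases hL : x ∈ hull L.1
      · exact Filter.Eventually.of_forall fun _ _ => hL
      · have : ∀ᶠ ε in nhds (0:ℝ), c ε ∈ (hull L.1)ᶜ :=
          hc.continuousAt.eventually_mem
            ((isCompact_hull L.1).isClosed.isOpen_compl.mem_nhds (by rw [hc0]; exact hL))
        exact this.mono fun ε h h' => absurd h' h
  obtain ⟨ε, ⟨hεΩ, hεL⟩, hε0⟩ :=
    ((hnear.filter_mono nhdsWithin_le_nhds).and (self_mem_nhdsWithin (s := Ioi (0:ℝ)))).exists
  have hε0 : 0 < ε := hε0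
  have hcl : c ε ∈ ⋃ L ∈ T.cells, hull L := by
    rw [T.cover]; exact subset_closure hεΩ
  simp only [mem_iUnion] at hcl
  obtain ⟨L, hL, hcL⟩ := hcl
  have hxL := hεL ⟨L, hL⟩ hcL
  have hLK : (⟨L, hL⟩ : T.Cell) ≠ K := by
    rintro rfl
    simp only at hK
    rw [hull, hK] at hcL
    push_cast at hcL
    have := area2_mul_nonneg_of_mem hcL
    rw [harea] at this
    have h2 : 0 < ε * (area2 z y y' * area2 z y y') := mul_pos hε0 (mul_self_pos.2 hD)
    linarith [show -ε * area2 z y y' * area2 z y y' = -(ε * (area2 z y y' * area2 z y y')) by ring]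
  have hxK : x ∈ hull K.1 := by
    rw [hull, hK]
    push_cast
    refine mem_convexHull_triple.2 ⟨0, 1 - t, t, le_rfl, by linarith, ht0.le, by ring, ?_⟩
    rw [hxdef]; module
  have hxKL : x ∈ convexHull ℝ ((K.1 : Set Plane) ∩ (L : Set Plane)) := by
    rw [← T.conforming K.1 K.2 L hL]; exact ⟨hxK, hxL⟩
  have hyL : y ∈ L := by
    by_contra hy
    have hsub : ((K.1 : Set Plane) ∩ (L : Set Plane)) ⊆ {y', z} := by
      rw [hK]
      rintro u ⟨hu1, hu2⟩
      simp only [Finset.coe_insert, Finset.coe_singleton, mem_insert_iff,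
        mem_singleton_iff] at hu1 ⊢
      rcases hu1 with rfl | rfl | rfl
      · simp
      · exact absurd hu2 hy
      · simp
    have h0 := area2_eq_zero_of_mem_segment (convexHull_mono hsub hxKL)
    have : area2 x y' z = (1 - t) * area2 z y y' := by
      rw [hxdef]; simp [area2, cross]; ring
    rw [this] at h0
    exact mul_ne_zero (by linarith) hD h0
  have hyL' : y' ∈ L := by
    by_contra hy
    have hsub : ((K.1 : Set Plane) ∩ (L : Set Plane)) ⊆ {z, y} := by
      rw [hK]
      rintro u ⟨hu1, hu2⟩
      simp only [Finset.coe_insert, Finset.coe_singleton, mem_insert_iff,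
        mem_singleton_iff] at hu1 ⊢
      rcases hu1 with rfl | rfl | rfl
      · simp
      · simp
      · exact absurd hu2 hy
    have h0 := area2_eq_zero_of_mem_segment (convexHull_mono hsub hxKL)
    have : area2 x z y = t * area2 z y y' := by
      rw [hxdef]; simp [area2, cross]; ring
    rw [this] at h0
    exact mul_ne_zero ht0.ne' hD h0
  have hEK : T.IsEdgeOf {y, y'} K := ⟨Finset.card_pair hyy, by rw [hK]; simp⟩
  have hEL : T.IsEdgeOf {y, y'} ⟨L, hL⟩ := ⟨Finset.card_pair hyy, by
    intro u hu
    simp only [Finset.mem_insert, Finset.mem_singleton] at hu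
    rcases hu with rfl | rfl
    · exact hyL
    · exact hyL'⟩
  exact hLK (hE.unique hEL hEK)

lemma disjoint_interior {K L : T.Cell} (hKL : K ≠ L) :
    Disjoint (interior (hull K.1)) (interior (hull L.1)) := by
  have hns : ¬ K.1 ⊆ L.1 := fun h => hKL (Subtype.ext (Finset.eq_of_subset_of_card_le h
    (by rw [(T.isTriangle K).card_eq, (T.isTriangle L).card_eq])))
  obtain ⟨z, hzK, hzL⟩ := Finset.not_subset.1 hns
  obtain ⟨y, y', hy, -, hK, hD⟩ := (T.isTriangle K).exists_erase_eq hzK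
  rw [Set.disjoint_left]
  intro p hpK hpL
  have hsub : interior (hull K.1) ∩ interior (hull L.1) ⊆ {x | area2 x y y' = 0} := by
    rintro x ⟨h1, h2⟩
    have h3 : x ∈ convexHull ℝ ((K.1 : Set Plane) ∩ (L.1 : Set Plane)) := by
      rw [← T.conforming K.1 K.2 L.1 L.2]
      exact ⟨interior_subset h1, interior_subset h2⟩
    refine area2_eq_zero_of_mem_segment (convexHull_mono ?_ h3)
    rintro u ⟨hu1, hu2⟩
    rw [hK] at hu1
    simp only [Finset.coe_insert, Finset.coe_singleton, mem_insert_iff, mem_singleton_iff] at hu1 ⊢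
    rcases hu1 with rfl | h
    · exact absurd hu2 hzL
    · exact h
  have hc : Continuous fun ε : ℝ => p + ε • (z - y) := by fun_prop
  have hev : ∀ᶠ ε in nhds (0:ℝ), p + ε • (z - y) ∈ interior (hull K.1) ∩ interior (hull L.1) :=
    hc.continuousAt.eventually_mem ((isOpen_interior.inter isOpen_interior).mem_nhds
      (by simpa using ⟨hpK, hpL⟩))
  obtain ⟨ε, h1, h2⟩ :=
    ((hev.filter_mono nhdsWithin_le_nhds).and (self_mem_nhdsWithin (s := Ioi (0:ℝ)))).exists
  have h2 : 0 < ε := h2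
  have h3 : area2 p y y' = 0 := hsub ⟨hpK, hpL⟩
  have h4 : area2 (p + ε • (z - y)) y y' = 0 := hsub h1
  have h5 : area2 (p + ε • (z - y)) y y' = area2 p y y' + ε * area2 z y y' := by
    simp [area2, cross]; ring
  rw [h5, h3, zero_add] at h4
  exact mul_ne_zero h2.ne' hD h4

end Triangulation

namespace Triangulation

variable {Ω : Set Plane} {T : Triangulation Ω}

/-! ### Integrals of piecewise functions -/

lemma hull_subset (K : T.Cell) : hull K.1 ⊆ closure Ω := by
  rw [← T.cover]
  exact subset_iUnion₂_of_subset K.1 K.2 Subset.rfl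

lemma interior_hull_subset (hΩreg : interior (closure Ω) = Ω) (K : T.Cell) :
    interior (hull K.1) ⊆ Ω :=
  (interior_mono (hull_subset K)).trans hΩreg.subset

lemma isCompact_closure (T : Triangulation Ω) : IsCompact (closure Ω) := by
  rw [← T.cover]
  exact T.cells.isCompact_biUnion fun K _ => isCompact_hull K

lemma volume_lt_top (T : Triangulation Ω) : volume Ω < ⊤ :=
  (measure_mono subset_closure).trans_lt T.isCompact_closure.measure_lt_top

lemma glue_of_mem {V : Type} [AddCommMonoid V] (g : T.Cell → Plane → V) {K : T.Cell} {x : Plane}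
    (hx : x ∈ interior (hull K.1)) : T.glue g x = g K x := by
  rw [glue, Finset.sum_eq_single K]
  · exact indicator_of_mem hx _
  · intro L _ hLK
    exact indicator_of_notMem (Set.disjoint_left.1 (disjoint_interior hLK.symm) hx) _
  · simp

lemma glue_of_notMem {V : Type} [AddCommMonoid V] (g : T.Cell → Plane → V) {x : Plane}
    (hx : ∀ K : T.Cell, x ∉ interior (hull K.1)) : T.glue g x = 0 := by
  rw [glue]
  exact Finset.sum_eq_zero fun K _ => indicator_of_notMem (hx K) _

/-- The integral over `Ω` of a function that is given piecewise. -/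
lemma integral_eq_sum (hΩreg : interior (closure Ω) = Ω) {F : Plane → ℝ} {G : T.Cell → Plane → ℝ}
    (hG : ∀ K, Continuous (G K)) (h : ∀ K, ∀ x ∈ interior (hull K.1), F x = G K x)
    (h0 : ∀ x, (∀ K : T.Cell, x ∉ interior (hull K.1)) → F x = 0) :
    ∫ x in Ω, F x = ∑ K, ∫ x in hull K.1, G K x := by
  have hF : F = fun x => ∑ K : T.Cell, (interior (hull K.1)).indicator (G K) x := by
    ext x
    change F x = T.glue G x
    by_cases hx : ∃ K : T.Cell, x ∈ interior (hull K.1)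
    · obtain ⟨K, hK⟩ := hx
      rw [glue_of_mem G hK, h K x hK]
    · push Not at hx
      rw [glue_of_notMem G hx, h0 x hx]
  have hi : ∀ K : T.Cell, IntegrableOn (G K) (interior (hull K.1)) := fun K =>
    ((hG K).continuousOn.integrableOn_compact (isCompact_hull K.1)).mono_set interior_subset
  have hm : ∀ K : T.Cell, MeasurableSet (interior (hull K.1)) := fun K =>
    isOpen_interior.measurableSet
  rw [hF, integral_finsetSum]
  · refine Finset.sum_congr rfl fun K _ => ?_
    rw [setIntegral_indicator (hm K), inter_eq_right.2 (interior_hull_subset hΩreg K),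
      integral_interior_hull]
  · intro K _
    rw [integrable_indicator_iff (hm K), IntegrableOn, Measure.restrict_restrict (hm K)]
    exact (hi K).mono_set inter_subset_left

lemma memLp_of_continuous (T : Triangulation Ω) {V : Type} [NormedAddCommGroup V]
    [SecondCountableTopologyEither Plane V] {f : Plane → V} (hf : Continuous f) :
    MemLp f 2 (volume.restrict Ω) := by
  have : IsFiniteMeasure (volume.restrict (closure Ω)) :=
    isFiniteMeasure_restrict.2 T.isCompact_closure.measure_lt_top.ne
  obtain ⟨C, hC⟩ := T.isCompact_closure.exists_bound_of_continuousOn hf.continuousOn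
  refine MemLp.mono_measure (Measure.restrict_mono subset_closure le_rfl)
    (MemLp.of_bound (C := C) hf.aestronglyMeasurable ?_)
  exact (ae_restrict_iff' isClosed_closure.measurableSet).2
    (Filter.Eventually.of_forall fun x hx => hC x hx)

lemma memLp_glue {V : Type} [NormedAddCommGroup V]
    [SecondCountableTopologyEither Plane V] {g : T.Cell → Plane → V} (hg : ∀ K, Continuous (g K)) :
    MemLp (T.glue g) 2 (volume.restrict Ω) := by
  have : T.glue g = fun x => ∑ K : T.Cell, (interior (hull K.1)).indicator (g K) x := rfl
  rw [this]
  exact memLp_finsetSum _ fun K _ =>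
    (T.memLp_of_continuous (hg K)).indicator isOpen_interior.measurableSet

/-! ### Normal jumps and the distributional divergence -/

/-- For Raviart-Thomas fields, the normal jump across a common edge vanishes if and only if the
outward fluxes of the two triangles cancel. -/
lemma outwardFlux_add_eq_zero_iff {K L : T.Cell} (hKL : K ≠ L) {z z' : Plane} (hz : z ∈ K.1)
    (hz' : z' ∈ L.1) (hE : K.1.erase z = L.1.erase z') {p q : Plane → Plane}
    (hp : ∃ (w : Plane) (d : ℝ), ∀ x, p x = w + d • x)
    (hq : ∃ (w : Plane) (d : ℝ), ∀ x, q x = w + d • x) :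
    outwardFlux p z (K.1.erase z) + outwardFlux q z' (L.1.erase z') = 0 ↔
      ∀ ν : Plane, ‖ν‖ = 1 →
        (∀ x ∈ K.1.erase z, ∀ y ∈ K.1.erase z, ⟪x - y, ν⟫ = 0) →
          ∀ x ∈ hull (K.1.erase z), ⟪p x - q x, ν⟫ = 0 := by
  obtain ⟨y, y', hy, he, hK, hD⟩ := (T.isTriangle K).exists_erase_eq hz
  have hL : L.1 = {z', y, y'} := by rw [← Finset.insert_erase hz', ← hE, he]
  have hD' : area2 z' y y' ≠ 0 := (hL ▸ T.isTriangle L).area2_ne_zero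
  have hneg := area2_mul_neg hKL hK hL
  obtain ⟨w, d, hp⟩ := hp
  obtain ⟨w', d', hq⟩ := hq
  rw [← hE, he, outwardFlux_pair _ _ hy, outwardFlux_pair _ _ hy]
  have hsign : (SignType.sign (area2 z' y y') : ℝ) = -(SignType.sign (area2 z y y') : ℝ) := by
    rcases mul_neg_iff.1 hneg with ⟨h1, h2⟩ | ⟨h1, h2⟩
    · simp [sign_pos h1, sign_neg h2]
    · simp [sign_pos h2, sign_neg h1]
  have hs0 : (SignType.sign (area2 z y y') : ℝ) ≠ 0 := by
    rcases lt_or_gt_of_ne hD with h | h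
    · simp [sign_neg h]
    · simp [sign_pos h]
  set m : Plane := (2⁻¹ : ℝ) • (y + y') with hm
  have hflux : (SignType.sign (area2 z y y') : ℝ) * cross (p m) (y' - y) +
      (SignType.sign (area2 z' y y') : ℝ) * cross (q m) (y' - y) = 0 ↔
      cross (p m - q m) (y' - y) = 0 := by
    rw [hsign]
    have : (SignType.sign (area2 z y y') : ℝ) * cross (p m) (y' - y) +
      -(SignType.sign (area2 z y y') : ℝ) * cross (q m) (y' - y) =
        (SignType.sign (area2 z y y') : ℝ) * cross (p m - q m) (y' - y) := by
      simp [cross]; ring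
    rw [this, mul_eq_zero, or_iff_right hs0]
  rw [hflux]
  constructor
  · intro h ν hν hperp x hx
    rw [hull] at hx
    push_cast at hx
    rw [convexHull_pair] at hx
    obtain ⟨r, s, hr, hs, hrs, rfl⟩ := hx
    obtain rfl : r = 1 - s := by linarith
    have hc : cross (p ((1 - s) • y + s • y') - q ((1 - s) • y + s • y')) (y' - y) = 0 := by
      rw [← h, hm, hp, hq, hp, hq]
      simp [cross]; ring
    set a := p ((1 - s) • y + s • y') - q ((1 - s) • y + s • y')
    have ht := hperp y' (by simp) y (by simp)
    rw [inner_eq_coords] at ht ⊢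
    rw [cross] at hc
    set t := y' - y with htdef
    have h0 : (a 0 * ν 0 + a 1 * ν 1) * t 0 = 0 := by
      linear_combination a 0 * ht - ν 1 * hc
    have h1 : (a 0 * ν 0 + a 1 * ν 1) * t 1 = 0 := by
      linear_combination a 1 * ht + ν 0 * hc
    by_contra hne
    have t0 := (mul_eq_zero.1 h0).resolve_left hne
    have t1 := (mul_eq_zero.1 h1).resolve_left hne
    apply hy
    have htz : t = 0 := by ext i; fin_cases i <;> simp [t0, t1]
    exact (sub_eq_zero.1 htz).symm
  · intro h
    have hJ : (!₂[(y' - y) 1, -(y' - y) 0] : Plane) ≠ 0 := by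
      intro h0
      apply hy
      have t0 := congrArg (fun u : Plane => u 0) h0
      have t1 := congrArg (fun u : Plane => u 1) h0
      simp at t0 t1
      ext i; fin_cases i <;> simp <;> linarith
    set J : Plane := !₂[(y' - y) 1, -(y' - y) 0] with hJdef
    have hJn : ‖J‖ ≠ 0 := norm_ne_zero_iff.2 hJ
    have hcr : ∀ u : Plane, ⟪u, J⟫ = cross u (y' - y) := by
      intro u; rw [inner_eq_coords, hJdef]; simp [cross]; ring
    have := h (‖J‖⁻¹ • J) (by rw [norm_smul, norm_inv, norm_norm, inv_mul_cancel₀ hJn]) ?_ m ?_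
    · rw [inner_smul_right, hcr] at this
      exact (mul_eq_zero.1 this).resolve_left (inv_ne_zero hJn)
    · intro u hu v hv
      rw [inner_smul_right, hcr]
      simp only [Finset.mem_insert, Finset.mem_singleton] at hu hv
      rcases hu with rfl | rfl <;> rcases hv with rfl | rfl <;> simp [cross] <;> right <;> ring
    · rw [hull]
      push_cast
      rw [convexHull_pair]
      exact ⟨2⁻¹, 2⁻¹, by norm_num, by norm_num, by norm_num, by rw [hm, smul_add]⟩

/-- Cancellation of the outward fluxes of a piecewise field across all interior edges. -/
def FluxCancel (q : T.Cell → Plane → Plane) : Prop :=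
  ∀ K L : T.Cell, K ≠ L → ∀ z ∈ K.1, ∀ z' ∈ L.1, K.1.erase z = L.1.erase z' →
    outwardFlux (q K) z (K.1.erase z) + outwardFlux (q L) z' (L.1.erase z') = 0

/-- Integration by parts for piecewise Raviart-Thomas fields and piecewise `C¹` functions. -/
lemma sum_integral_green {q : T.Cell → Plane → Plane} {w : T.Cell → Plane} {d : T.Cell → ℝ}
    (hq : ∀ K x, q K x = w K + d K • x) {v : T.Cell → Plane → ℝ} (hv : ∀ K, ContDiff ℝ 1 (v K)) :
    ∑ K : T.Cell, ∫ x in hull K.1, (⟪q K x, gradient (v K) x⟫ + 2 * d K * v K x) =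
      ∑ K : T.Cell, ∑ z ∈ K.1,
        outwardFlux (q K) z (K.1.erase z) * edgeMean (v K) (K.1.erase z) :=
  Finset.sum_congr rfl fun K _ => (T.isTriangle K).integral_green (hq K) (hv K)

lemma continuous_gradient {v : Plane → ℝ} (hv : ContDiff ℝ 1 v) : Continuous (gradient v) :=
  (InnerProductSpace.toDual ℝ Plane).symm.continuous.comp (hv.continuous_fderiv (by norm_num))

/-- A piecewise Raviart-Thomas field whose fluxes cancel has the piecewise divergence as its
distributional divergence. -/
lemma isWeakDiv_glue (hΩreg : interior (closure Ω) = Ω) {q : T.Cell → Plane → Plane}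
    {w : T.Cell → Plane} {d : T.Cell → ℝ} (hq : ∀ K x, q K x = w K + d K • x)
    (hflux : FluxCancel q) : IsWeakDiv Ω (T.glue q) (T.const fun K => 2 * d K) := by
  refine ⟨memLp_glue fun K => continuous_const, fun φ hφ _ hsupp => ?_⟩
  have hφ1 : ContDiff ℝ 1 φ := hφ.of_le (by norm_num)
  have hgr := continuous_gradient hφ1
  have hφc := hφ1.continuous
  have hqc : ∀ K, Continuous (q K) := fun K => by
    have : q K = fun x => w K + d K • x := funext (hq K)
    rw [this]; fun_prop
  have h1 : ∫ x in Ω, ⟪T.glue q x, gradient φ x⟫ =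
      ∑ K : T.Cell, ∫ x in hull K.1, ⟪q K x, gradient φ x⟫ := by
    refine integral_eq_sum hΩreg (fun K => (hqc K).inner hgr) ?_ ?_
    · intro K x hx; rw [glue_of_mem q hx]
    · intro x hx; rw [glue_of_notMem q hx, inner_zero_left]
  have h2 : ∫ x in Ω, T.const (fun K => 2 * d K) x * φ x =
      ∑ K : T.Cell, ∫ x in hull K.1, 2 * d K * φ x := by
    refine integral_eq_sum hΩreg (fun K => by fun_prop) ?_ ?_
    · intro K x hx; rw [const, glue_of_mem _ hx]
    · intro x hx; rw [const, glue_of_notMem _ hx, zero_mul]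
  rw [h1, h2, eq_neg_iff_add_eq_zero, ← Finset.sum_add_distrib]
  have h3 : ∀ K : T.Cell, ∫ x in hull K.1, ⟪q K x, gradient φ x⟫ +
      2 * d K * φ x = (∫ x in hull K.1, ⟪q K x, gradient φ x⟫) + ∫ x in hull K.1, 2 * d K * φ x :=
    fun K => integral_add
      (((hqc K).inner hgr).continuousOn.integrableOn_compact (isCompact_hull _))
      ((Continuous.continuousOn (by fun_prop)).integrableOn_compact (isCompact_hull _))
  rw [← Finset.sum_congr rfl fun K _ => h3 K, sum_integral_green hq fun _ => hφ1]
  refine sum_edges_eq_zero _ ?_ ?_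
  · intro K L hKL z hz z' hz' hE
    rw [← hE, ← add_mul]
    have := hflux K L hKL z hz z' hz' hE
    rw [← hE] at this
    rw [this, zero_mul]
  · intro K z hz hb
    obtain ⟨y, y', hy, he, hK, -⟩ := (T.isTriangle K).exists_erase_eq hz
    rw [he] at hb ⊢
    have : edgeMean φ {y, y'} = 0 := by
      rw [edgeMean_pair φ hy, segMean, intervalIntegral.integral_of_le zero_le_one,
        integral_Ioc_eq_integral_Ioo]
      refine setIntegral_eq_zero_of_forall_eq_zero fun t ht => ?_
      by_contra hne
      exact notMem_of_isBoundaryEdge hΩreg hK hy hb ht.1 ht.2 (hsupp (subset_tsupport _ hne))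
    rw [this, mul_zero]

lemma isWeakDiv_unique (hΩ : IsOpen Ω) (T : Triangulation Ω) {q : Plane → Plane}
    {g₁ g₂ : Plane → ℝ} (h₁ : IsWeakDiv Ω q g₁) (h₂ : IsWeakDiv Ω q g₂) :
    g₁ =ᵐ[volume.restrict Ω] g₂ := by
  have : IsFiniteMeasure (volume.restrict Ω) := isFiniteMeasure_restrict.2 T.volume_lt_top.ne
  have hint : IntegrableOn (fun x => g₁ x - g₂ x) Ω :=
    (h₁.1.sub h₂.1).integrable (by norm_num)
  have key := hΩ.ae_eq_zero_of_integral_contDiff_smul_eq_zero hint.locallyIntegrableOn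
    (fun φ hφ hc hs => ?_)
  · rw [Filter.EventuallyEq, ae_restrict_iff' hΩ.measurableSet]
    filter_upwards [key] with x hx hxΩ
    exact sub_eq_zero.1 (hx hxΩ)
  · have hφ2 : MemLp φ 2 (volume.restrict Ω) := T.memLp_of_continuous hφ.continuous
    rw [← setIntegral_eq_integral_of_forall_compl_eq_zero (s := Ω)]
    · have i₁ : Integrable (fun x => g₁ x * φ x) (volume.restrict Ω) := h₁.1.integrable_mul hφ2
      have i₂ : Integrable (fun x => g₂ x * φ x) (volume.restrict Ω) := h₂.1.integrable_mul hφ2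
      have e : ∀ x, φ x • (g₁ x - g₂ x) = g₁ x * φ x - g₂ x * φ x := fun x => by
        rw [smul_eq_mul]; ring
      simp only [e]
      rw [integral_sub i₁ i₂]
      have e1 := h₁.2 φ hφ hc hs
      have e2 := h₂.2 φ hφ hc hs
      linarith
    · intro x hx
      have : φ x = 0 := by
        by_contra hne
        exact hx (hs (subset_tsupport _ hne))
      rw [this, zero_smul]

lemma isRT0_of_fluxCancel (hΩreg : interior (closure Ω) = Ω) {q : T.Cell → Plane → Plane}
    {w : T.Cell → Plane} {d : T.Cell → ℝ} (hq : ∀ K x, q K x = w K + d K • x)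
    (hflux : FluxCancel q) : T.IsRT0 q where
  shape K := ⟨w K, d K, hq K⟩
  memHdiv := by
    refine ⟨memLp_glue fun K => ?_, _, isWeakDiv_glue hΩreg hq hflux⟩
    have : q K = fun x => w K + d K • x := funext (hq K)
    rw [this]; fun_prop
  jump E K L hKL hK hL := by
    obtain ⟨z, hz, rfl⟩ := isEdgeOf_iff.1 hK
    obtain ⟨z', hz', hE⟩ := isEdgeOf_iff.1 hL
    exact (outwardFlux_add_eq_zero_iff hKL hz hz' hE ⟨_, _, hq K⟩ ⟨_, _, hq L⟩).1
      (hflux K L hKL z hz z' hz' hE)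

lemma IsRT0.fluxCancel {q : T.Cell → Plane → Plane} (hq : T.IsRT0 q) : FluxCancel q := by
  intro K L hKL z hz z' hz' hE
  exact (outwardFlux_add_eq_zero_iff hKL hz hz' hE (hq.shape K) (hq.shape L)).2
    (hq.jump _ K L hKL (isEdgeOf_erase K hz) (by rw [hE]; exact isEdgeOf_erase L hz'))

lemma IsRT0.weakDiv_ae_eq (hΩ : IsOpen Ω) (hΩreg : interior (closure Ω) = Ω)
    {q : T.Cell → Plane → Plane} (h : T.IsRT0 q) {w : T.Cell → Plane} {d : T.Cell → ℝ}
    (hq : ∀ K x, q K x = w K + d K • x) :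
    weakDiv Ω (T.glue q) =ᵐ[volume.restrict Ω] T.const fun K => 2 * d K := by
  have hw := isWeakDiv_glue hΩreg hq h.fluxCancel
  have hex : ∃ g, IsWeakDiv Ω (T.glue q) g := ⟨_, hw⟩
  rw [weakDiv, dif_pos hex]
  exact isWeakDiv_unique hΩ T hex.choose_spec hw

/-- The cancellation that links the two methods: the fluxes of a Raviart-Thomas field against the
edge means of a Crouzeix-Raviart function sum to zero. -/
lemma FluxCancel.sum_eq_zero {q : T.Cell → Plane → Plane} (hq : FluxCancel q)
    {v : T.Cell → Plane → ℝ} (hv : T.IsCR0 v) :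
    ∑ K : T.Cell, ∑ z ∈ K.1,
        outwardFlux (q K) z (K.1.erase z) * edgeMean (v K) (K.1.erase z) = 0 := by
  have hmean : ∀ K : T.Cell, ∀ z ∈ K.1,
      edgeMean (v K) (K.1.erase z) = v K (mid (K.1.erase z)) := by
    intro K z hz
    obtain ⟨a, c, h⟩ := hv.affine K
    have : v K = fun x => ⟪a, x⟫ + c := funext h
    rw [this, edgeMean_affine (isEdgeOf_erase K hz).1]
  refine sum_edges_eq_zero _ ?_ ?_
  · intro K L hKL z hz z' hz' hE
    have h1 := hq K L hKL z hz z' hz' hE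
    have h2 : edgeMean (v L) (L.1.erase z') = edgeMean (v K) (K.1.erase z) := by
      rw [hmean K z hz, hmean L z' hz', ← hE]
      exact hv.continuous_mid _ L K (by rw [hE]; exact isEdgeOf_erase L hz') (isEdgeOf_erase K hz)
    rw [h2, ← add_mul, h1, zero_mul]
  · intro K z hz hb
    rw [hmean K z hz, hv.boundary _ K hb (isEdgeOf_erase K hz), mul_zero]

end Triangulation

/-! ### Matrices acting on the plane -/

lemma act_add (M : Matrix (Fin 2) (Fin 2) ℝ) (u v : Plane) : act M (u + v) = act M u + act M v :=
  map_add _ _ _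

lemma act_smul (M : Matrix (Fin 2) (Fin 2) ℝ) (r : ℝ) (v : Plane) : act M (r • v) = r • act M v :=
  map_smul _ _ _

lemma act_neg (M : Matrix (Fin 2) (Fin 2) ℝ) (v : Plane) : act M (-v) = -act M v :=
  map_neg _ _

lemma act_apply (M : Matrix (Fin 2) (Fin 2) ℝ) (v : Plane) (i : Fin 2) :
    act M v i = M i 0 * v 0 + M i 1 * v 1 := by
  fin_cases i <;> simp [act, Matrix.toLpLin_apply]

lemma continuous_act (M : Matrix (Fin 2) (Fin 2) ℝ) : Continuous (act M) :=
  (LinearMap.toContinuousLinearMap (Matrix.toEuclideanLin M)).continuous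

lemma act_act_inv {M : Matrix (Fin 2) (Fin 2) ℝ} (hM : M.det ≠ 0) (v : Plane) :
    act M (act M⁻¹ v) = v := by
  have h := Matrix.mul_nonsing_inv M (isUnit_iff_ne_zero.2 hM)
  simp only [act, Matrix.toLpLin_apply, Matrix.mulVec_mulVec, h, Matrix.one_mulVec]

lemma act_inv_act {M : Matrix (Fin 2) (Fin 2) ℝ} (hM : M.det ≠ 0) (v : Plane) :
    act M⁻¹ (act M v) = v := by
  have h := Matrix.nonsing_inv_mul M (isUnit_iff_ne_zero.2 hM)
  simp only [act, Matrix.toLpLin_apply, Matrix.mulVec_mulVec, h, Matrix.one_mulVec]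

lemma inner_act_left (M : Matrix (Fin 2) (Fin 2) ℝ) (u v : Plane) :
    ⟪act M u, v⟫ = ⟪act M.transpose v, u⟫ := by
  simp only [inner_eq_coords, act_apply, Matrix.transpose_apply]; ring

lemma det_ne_zero_of_coercive {M : Matrix (Fin 2) (Fin 2) ℝ} {α : ℝ} (hα : 0 < α)
    (h : ∀ ξ : Plane, α * ‖ξ‖ ^ 2 ≤ ⟪act M ξ, ξ⟫) : M.det ≠ 0 := by
  intro h0
  obtain ⟨v, hv, hMv⟩ := Matrix.exists_mulVec_eq_zero_iff.2 h0
  have h1 := h (WithLp.toLp 2 v)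
  have h2 : act M (WithLp.toLp 2 v) = 0 := by
    simp [act, Matrix.toLpLin_apply, hMv]
  rw [h2, inner_zero_left] at h1
  have h3 : 0 < ‖(WithLp.toLp 2 v : Plane)‖ := by
    rw [norm_pos_iff]
    intro h4
    exact hv (by simpa using congrArg WithLp.ofLp h4)
  have : 0 < α * ‖(WithLp.toLp 2 v : Plane)‖ ^ 2 := by positivity
  linarith

/-! ### Local basis functions -/

/-- An affine function on a triangle with prescribed values at the midpoints of the edges. -/
lemma IsTriangle.exists_affine {K : Finset Plane} (hK : IsTriangle K) (μ : Finset Plane → ℝ) :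
    ∃ (w : Plane) (k : ℝ), ∀ z ∈ K, ⟪w, mid (K.erase z)⟫ + k = μ (K.erase z) := by
  obtain ⟨a, b, c, hab, hac, hbc, rfl, h⟩ := hK.exists_eq
  have ea : ({a, b, c} : Finset Plane).erase a = {b, c} := by ext x; simp; grind
  have eb : ({a, b, c} : Finset Plane).erase b = {a, c} := by ext x; simp; grind
  have ec : ({a, b, c} : Finset Plane).erase c = {a, b} := by ext x; simp; grind
  have harea : ∀ y z x : Plane, area2 x y z =
      ⟪(!₂[y 1 - z 1, z 0 - y 0] : Plane), x⟫ + cross y z := by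
    intro y z x
    simp [inner_eq_coords, area2, cross]; ring
  -- the function `∑ μ_z (1 - 2 λ_z)` with the barycentric coordinates `λ_z`
  have key : ∃ (w : Plane) (k : ℝ), ∀ x, ⟪w, x⟫ + k = μ {b, c} + μ {a, c} + μ {a, b} -
      2 / area2 a b c * (μ {b, c} * area2 x b c + μ {a, c} * area2 x c a +
        μ {a, b} * area2 x a b) := by
    refine ⟨(-(2 / area2 a b c)) • (μ {b, c} • !₂[b 1 - c 1, c 0 - b 0] +
      μ {a, c} • !₂[c 1 - a 1, a 0 - c 0] + μ {a, b} • !₂[a 1 - b 1, b 0 - a 0]),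
      μ {b, c} + μ {a, c} + μ {a, b} - 2 / area2 a b c * (μ {b, c} * cross b c +
        μ {a, c} * cross c a + μ {a, b} * cross a b), fun x => ?_⟩
    rw [harea b c x, harea c a x, harea a b x, real_inner_smul_left, inner_add_left, inner_add_left,
      real_inner_smul_left, real_inner_smul_left, real_inner_smul_left]
    ring
  obtain ⟨w, k, hw⟩ := key
  refine ⟨w, k, fun z hz => ?_⟩
  rw [hw]
  simp only [Finset.mem_insert, Finset.mem_singleton] at hz
  rcases hz with rfl | rfl | rfl
  · rw [ea, mid_pair hbc]; field_simp; simp [area2, cross]; ring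
  · rw [eb, mid_pair hac]; field_simp; simp [area2, cross]; ring
  · rw [ec, mid_pair hab]; field_simp; simp [area2, cross]; ring

/-- A Raviart-Thomas field on a triangle with prescribed fluxes through the edges. -/
lemma IsTriangle.exists_field {K : Finset Plane} (hK : IsTriangle K) (F : Plane → ℝ) :
    ∃ (w : Plane) (d : ℝ), ∀ z ∈ K, outwardFlux (fun x => w + d • x) z (K.erase z) = F z := by
  obtain ⟨a, b, c, hab, hac, hbc, rfl, h⟩ := hK.exists_eq
  have ea : ({a, b, c} : Finset Plane).erase a = {b, c} := by ext x; simp; grind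
  have eb : ({a, b, c} : Finset Plane).erase b = {c, a} := by ext x; simp; grind
  have ec : ({a, b, c} : Finset Plane).erase c = {a, b} := by ext x; simp; grind
  have r1 : area2 b c a = area2 a b c := area2_rotate a b c
  have r2 : area2 c a b = area2 a b c := by rw [area2_rotate, area2_rotate]
  have hD : |area2 a b c| ≠ 0 := abs_ne_zero.2 h
  -- the field `∑ F_z (x - z) / |area2 a b c|`
  have key : ∀ y z : Plane, cross ((-(|area2 a b c|⁻¹)) • (F a • a + F b • b + F c • c) +
      (|area2 a b c|⁻¹ * (F a + F b + F c)) • ((2⁻¹ : ℝ) • (y + z))) (z - y) =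
      |area2 a b c|⁻¹ * (F a * area2 a y z + F b * area2 b y z + F c * area2 c y z) := by
    intro y z
    simp [area2, cross]; ring
  have z1 : ∀ y z : Plane, area2 y y z = 0 := fun y z => by simp [area2, cross]
  have z2 : ∀ y z : Plane, area2 z y z = 0 := fun y z => by simp [area2, cross]
  refine ⟨(-(|area2 a b c|⁻¹)) • (F a • a + F b • b + F c • c),
    |area2 a b c|⁻¹ * (F a + F b + F c), fun z hz => ?_⟩
  have hs := sign_mul_eq_abs (area2 a b c)
  simp only [Finset.mem_insert, Finset.mem_singleton] at hz
  rcases hz with rfl | rfl | rfl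
  · rw [ea, outwardFlux_pair _ _ hbc, key, z1, z2]
    field_simp
    linear_combination F z * hs
  · rw [eb, outwardFlux_pair _ _ hac.symm, key, z1, z2, r1]
    field_simp
    linear_combination F z * hs
  · rw [ec, outwardFlux_pair _ _ hab, key, z1, z2, r2]
    field_simp
    linear_combination F z * hs

namespace Triangulation

variable {Ω : Set Plane} {T : Triangulation Ω}

lemma det_projMat_ne_zero (hΩreg : interior (closure Ω) = Ω)
    {A : Plane → Matrix (Fin 2) (Fin 2) ℝ}
    (hA : ∀ i j, MemLp (fun x => A x i j) ⊤ (volume.restrict Ω)) {α : ℝ} (hα : 0 < α)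
    (hAell : ∀ᵐ x ∂volume.restrict Ω, ∀ ξ : Plane, α * ‖ξ‖ ^ 2 ≤ ⟪act (A x) ξ, ξ⟫) (K : T.Cell) :
    (T.projMat A K).det ≠ 0 := by
  refine det_ne_zero_of_coercive hα fun ξ => ?_
  have hle : volume.restrict (interior (hull K.1)) ≤ volume.restrict Ω :=
    Measure.restrict_mono (interior_hull_subset hΩreg K) le_rfl
  have hfin : IsFiniteMeasure (volume.restrict Ω) := isFiniteMeasure_restrict.2 T.volume_lt_top.ne
  have hi : ∀ i j, Integrable (fun x => A x i j) (volume.restrict (interior (hull K.1))) :=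
    fun i j => ((hA i j).integrable le_top).mono_measure hle
  have hV := (T.isTriangle K).volume_pos
  have hproj : ∀ i j, T.projMat A K i j =
      (volume.real (hull K.1))⁻¹ * ∫ x in interior (hull K.1), A x i j := by
    intro i j
    rw [integral_interior_hull, projMat, Matrix.of_apply, proj, setAverage_eq, smul_eq_mul]
  have hform : ∫ x in interior (hull K.1), ⟪act (A x) ξ, ξ⟫ =
      volume.real (hull K.1) * ⟪act (T.projMat A K) ξ, ξ⟫ := by
    simp only [inner_eq_coords, act_apply, hproj]
    rw [integral_add, integral_mul_const, integral_mul_const, integral_add, integral_add,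
      integral_mul_const, integral_mul_const, integral_mul_const, integral_mul_const]
    · field_simp
    all_goals
      first
      | exact (hi _ _).mul_const _
      | exact (((hi _ _).mul_const _).add ((hi _ _).mul_const _)).mul_const _
  have hmono : ∫ _ in interior (hull K.1), α * ‖ξ‖ ^ 2 ≤
      ∫ x in interior (hull K.1), ⟪act (A x) ξ, ξ⟫ := by
    refine integral_mono_ae ?_ ?_ ?_
    · exact integrableOn_const
        ((measure_mono interior_subset).trans_lt (isCompact_hull K.1).measure_lt_top).ne
    · simp only [inner_eq_coords, act_apply]
      exact ((((hi _ _).mul_const _).add ((hi _ _).mul_const _)).mul_const _).add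
        ((((hi _ _).mul_const _).add ((hi _ _).mul_const _)).mul_const _)
    · exact (hAell.filter_mono (ae_mono hle)).mono fun x hx => hx ξ
  rw [hform, integral_interior_hull, setIntegral_const, smul_eq_mul] at hmono
  exact le_of_mul_le_mul_left hmono hV

/-! ### Global basis functions -/

lemma exists_isCR0 (T : Triangulation Ω) (μ : Finset Plane → ℝ)
    (hμ : ∀ E, T.IsBoundaryEdge E → μ E = 0) :
    ∃ v, T.IsCR0 v ∧ ∀ K : T.Cell, ∀ z ∈ K.1, edgeMean (v K) (K.1.erase z) = μ (K.1.erase z) := by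
  choose w k hw using fun K : T.Cell => (T.isTriangle K).exists_affine μ
  have hmid : ∀ (E : Finset Plane) (K : T.Cell), T.IsEdgeOf E K → ⟪w K, mid E⟫ + k K = μ E := by
    intro E K hE
    obtain ⟨z, hz, rfl⟩ := isEdgeOf_iff.1 hE
    exact hw K z hz
  refine ⟨fun K x => ⟪w K, x⟫ + k K, ⟨fun K => ⟨w K, k K, fun _ => rfl⟩, ?_, ?_⟩, ?_⟩
  · intro E K L hK hL
    simp only [hmid E K hK, hmid E L hL]
  · intro E K hb hE
    simp only [hmid E K hE, hμ E hb]
  · intro K z hz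
    rw [edgeMean_affine (isEdgeOf_erase K hz).1, hw K z hz]

/-- The fluxes of a piecewise field cancel across all interior edges if they are orthogonal to the
edge means of all Crouzeix-Raviart functions. -/
lemma fluxCancel_of_sum_eq_zero {q : T.Cell → Plane → Plane}
    (h : ∀ v, T.IsCR0 v → ∑ K : T.Cell, ∑ z ∈ K.1,
      outwardFlux (q K) z (K.1.erase z) * edgeMean (v K) (K.1.erase z) = 0) : FluxCancel q := by
  classical
  intro K L hKL z hz z' hz' hE
  have hEK := isEdgeOf_erase K hz
  have hEL : T.IsEdgeOf (K.1.erase z) L := by rw [hE]; exact isEdgeOf_erase L hz'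
  -- test with the basis function of the common edge
  obtain ⟨v, hv, hval⟩ := T.exists_isCR0 (fun E => if E = K.1.erase z then 1 else 0) (by
    intro E hb
    refine if_neg ?_
    rintro rfl
    exact hKL (hb.unique hEK hEL))
  have hone : ∀ (M : T.Cell) (y : Plane), y ∈ M.1 → M.1.erase y = K.1.erase z →
      ∑ x ∈ M.1, outwardFlux (q M) x (M.1.erase x) * edgeMean (v M) (M.1.erase x) =
        outwardFlux (q M) y (M.1.erase y) := by
    intro M y hy he
    rw [Finset.sum_eq_single_of_mem y hy, hval M y hy, if_pos he, mul_one]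
    intro x hx hxy
    rw [hval M x hx, if_neg, mul_zero]
    exact fun he' => hxy ((Finset.erase_inj (s := M.1) hx).1 (he'.trans he.symm))
  have := h v hv
  rw [Finset.sum_eq_add_of_mem K L (Finset.mem_univ _) (Finset.mem_univ _) hKL, hone K z hz rfl,
    hone L z' hz' hE.symm] at this
  · exact this
  · rintro M - ⟨hMK, hML⟩
    refine Finset.sum_eq_zero fun x hx => ?_
    rw [hval M x hx, if_neg, mul_zero]
    intro he
    have hEM : T.IsEdgeOf (K.1.erase z) M := by rw [← he]; exact isEdgeOf_erase M hx
    exact (eq_or_eq_of_isEdgeOf hKL hEK hEL hEM).elim hMK hML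

/-- A piecewise affine function is in the Crouzeix-Raviart space as soon as its edge means are
orthogonal to the fluxes of all Raviart-Thomas fields. -/
lemma isCR0_of_sum_eq_zero (hΩreg : interior (closure Ω) = Ω) {u : T.Cell → Plane → ℝ}
    {a : T.Cell → Plane} {c : T.Cell → ℝ} (hu : ∀ K x, u K x = ⟪a K, x⟫ + c K)
    (h : ∀ q, T.IsRT0 q → ∑ K : T.Cell, ∑ z ∈ K.1,
      outwardFlux (q K) z (K.1.erase z) * edgeMean (u K) (K.1.erase z) = 0) : T.IsCR0 u := by
  classical
  have hmean : ∀ K : T.Cell, ∀ z ∈ K.1,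
      edgeMean (u K) (K.1.erase z) = u K (mid (K.1.erase z)) := by
    intro K z hz
    have : u K = fun x => ⟪a K, x⟫ + c K := funext (hu K)
    rw [this, edgeMean_affine (isEdgeOf_erase K hz).1]
  -- the basis field of an edge `E` of `K`: outward flux `1` on `K` and `-1` on the other triangle
  have hbasis : ∀ (E : Finset Plane) (K : T.Cell), T.IsEdgeOf E K → ∃ q, T.IsRT0 q ∧
      ∀ M : T.Cell, ∀ x ∈ M.1, outwardFlux (q M) x (M.1.erase x) =
        if M.1.erase x = E then (if M = K then 1 else -1) else 0 := by
    intro E K hE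
    choose w d hw using fun M : T.Cell => (T.isTriangle M).exists_field
      (fun x => if M.1.erase x = E then (if M = K then 1 else -1) else 0)
    refine ⟨fun M x => w M + d M • x, isRT0_of_fluxCancel hΩreg (fun _ _ => rfl) ?_, hw⟩
    intro M N hMN x hx y hy hxy
    simp only
    rw [hw M x hx, hw N y hy, ← hxy]
    by_cases he : M.1.erase x = E
    · have hM : T.IsEdgeOf E M := he ▸ isEdgeOf_erase M hx
      have hN : T.IsEdgeOf E N := by rw [← he, hxy]; exact isEdgeOf_erase N hy
      rcases eq_or_eq_of_isEdgeOf hMN hM hN hE with rfl | rfl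
      · simp [he, hMN.symm]
      · simp [he, hMN]
    · simp [he]
  have hone : ∀ (M : T.Cell) (y : Plane) (g : Plane → ℝ), y ∈ M.1 →
      (∀ x ∈ M.1, M.1.erase x ≠ M.1.erase y → g x = 0) → ∑ x ∈ M.1, g x = g y := by
    intro M y g hy hg
    refine Finset.sum_eq_single_of_mem y hy fun x hx hxy => hg x hx fun he => ?_
    exact hxy ((Finset.erase_inj (s := M.1) hx).1 he)
  refine ⟨fun K => ⟨a K, c K, hu K⟩, ?_, ?_⟩
  · intro E K L hK hL
    rcases eq_or_ne K L with rfl | hKL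
    · rfl
    obtain ⟨q, hq, hflux⟩ := hbasis E K hK
    have hsum := h q hq
    obtain ⟨z, hz, he⟩ := isEdgeOf_iff.1 hK
    obtain ⟨z', hz', he'⟩ := isEdgeOf_iff.1 hL
    rw [Finset.sum_eq_add_of_mem K L (Finset.mem_univ _) (Finset.mem_univ _) hKL,
      hone K z _ hz (fun x hx hne => by rw [hflux K x hx, if_neg (he ▸ hne), zero_mul]),
      hone L z' _ hz' (fun x hx hne => by rw [hflux L x hx, if_neg (he' ▸ hne), zero_mul]),
      hflux K z hz, hflux L z' hz', hmean K z hz, hmean L z' hz', if_pos he.symm, if_pos he'.symm,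
      if_pos rfl, if_neg hKL.symm, ← he, ← he'] at hsum
    · linarith
    · rintro M - ⟨hMK, hML⟩
      refine Finset.sum_eq_zero fun x hx => ?_
      rw [hflux M x hx, if_neg, zero_mul]
      intro hx'
      have hEM : T.IsEdgeOf E M := hx' ▸ isEdgeOf_erase M hx
      exact (eq_or_eq_of_isEdgeOf hKL hK hL hEM).elim hMK hML
  · intro E K hb hK
    obtain ⟨q, hq, hflux⟩ := hbasis E K hK
    have hsum := h q hq
    obtain ⟨z, hz, he⟩ := isEdgeOf_iff.1 hK
    rw [Finset.sum_eq_single_of_mem K (Finset.mem_univ _),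
      hone K z _ hz (fun x hx hne => by rw [hflux K x hx, if_neg (he ▸ hne), zero_mul]),
      hflux K z hz, hmean K z hz, if_pos he.symm, if_pos rfl, ← he, one_mul] at hsum
    · exact hsum
    · intro M _ hMK
      refine Finset.sum_eq_zero fun x hx => ?_
      rw [hflux M x hx, if_neg, zero_mul]
      intro hx'
      exact hMK (hb.unique (hx' ▸ isEdgeOf_erase M hx) hK)

end Triangulation

namespace Triangulation

variable {Ω : Set Plane} {T : Triangulation Ω}

/-! ### The two schemes in terms of fluxes and edge means -/

lemma proj_affine (K : T.Cell) (w : Plane) (k : ℝ) :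
    T.proj (fun x => ⟪w, x⟫ + k) K = ⟪w, mid K.1⟫ + k := by
  rw [proj, setAverage_eq, (T.isTriangle K).integral_affine, smul_eq_mul,
    inv_mul_cancel_left₀ (T.isTriangle K).volume_pos.ne']

lemma integral_const_mul_const (hΩreg : interior (closure Ω) = Ω) (g v : T.P0) :
    ∫ x in Ω, T.const g x * T.const v x =
      ∑ K : T.Cell, volume.real (hull K.1) * (g K * v K) := by
  rw [integral_eq_sum hΩreg (G := fun K _ => g K * v K) (fun K => continuous_const)]
  · simp only [setIntegral_const, smul_eq_mul]
  · intro K x hx; rw [const, const, glue_of_mem _ hx, glue_of_mem _ hx]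
  · intro x hx; rw [const, const, glue_of_notMem _ hx, zero_mul]

lemma integral_const_mul_affine (hΩreg : interior (closure Ω) = Ω) (g : T.P0)
    {v : T.Cell → Plane → ℝ} {a : T.Cell → Plane} {c : T.Cell → ℝ}
    (hv : ∀ K x, v K x = ⟪a K, x⟫ + c K) :
    ∫ x in Ω, T.const g x * T.glue v x =
      ∑ K : T.Cell, volume.real (hull K.1) * (g K * (⟪a K, mid K.1⟫ + c K)) := by
  rw [integral_eq_sum hΩreg (G := fun K x => g K * (⟪a K, x⟫ + c K)) (fun K => by fun_prop)]
  · refine Finset.sum_congr rfl fun K _ => ?_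
    rw [integral_const_mul, (T.isTriangle K).integral_affine]
    ring
  · intro K x hx; rw [const, glue_of_mem _ hx, glue_of_mem _ hx, hv]
  · intro x hx; rw [const, glue_of_notMem _ hx, zero_mul]

/-- The pairing of fluxes and edge means, written with the values of the field and of the function
at the centroids. -/
lemma sum_flux_mul_edgeMean {q : T.Cell → Plane → Plane} {Q : T.Cell → Plane} {d : T.Cell → ℝ}
    (hq : ∀ K x, q K x = Q K + d K • (x - mid K.1)) {v : T.Cell → Plane → ℝ}
    {a : T.Cell → Plane} {c : T.Cell → ℝ} (hv : ∀ K x, v K x = ⟪a K, x⟫ + c K) :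
    ∑ K : T.Cell, ∑ z ∈ K.1, outwardFlux (q K) z (K.1.erase z) * edgeMean (v K) (K.1.erase z) =
      ∑ K : T.Cell, volume.real (hull K.1) *
        (⟪Q K, a K⟫ + 2 * d K * (⟪a K, mid K.1⟫ + c K)) := by
  have hv' : ∀ K, v K = fun x => ⟪a K, x⟫ + c K := fun K => funext (hv K)
  rw [← sum_integral_green (w := fun K => Q K - d K • mid K.1) (d := d)
    (fun K x => by rw [hq]; module)
    (fun K => by rw [hv' K]; exact (contDiff_const.inner ℝ contDiff_id).add contDiff_const)]
  refine Finset.sum_congr rfl fun K _ => ?_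
  have e : ∀ x, ⟪q K x, gradient (v K) x⟫ + 2 * d K * v K x =
      ⟪(3 * d K) • a K, x⟫ + (⟪Q K, a K⟫ - d K * ⟪a K, mid K.1⟫ + 2 * d K * c K) := by
    intro x
    rw [hv' K, gradient_affine, hq, inner_add_left, real_inner_smul_left, real_inner_smul_left,
      inner_sub_left, real_inner_comm (a K) x, real_inner_comm (a K) (mid K.1)]
    ring
  simp only [e]
  rw [(T.isTriangle K).integral_affine, real_inner_smul_left]
  ring

variable {A : Plane → Matrix (Fin 2) (Fin 2) ℝ} {b : Plane → Plane} {γ f : Plane → ℝ}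

lemma pM_eq {u : T.Cell → Plane → ℝ} {a : T.Cell → Plane} {c : T.Cell → ℝ}
    (hu : ∀ K x, u K x = ⟪a K, x⟫ + c K) (K : T.Cell) (x : Plane) :
    T.pM A b γ f u K x = -(act (T.projMat A K) (a K) + T.uM A γ f u K • T.proj b K) +
      ((T.proj f K - T.proj γ K * T.uM A γ f u K) / 2) • (x - mid K.1) := by
  have : u K = fun x => ⟪a K, x⟫ + c K := funext (hu K)
  rw [pM, gradNC, this, gradient_affine, smul_smul]
  congr 2
  ring

/-- The residual of the modified Crouzeix-Raviart problem is minus the pairing of the fluxes of the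
reconstructed field with the edge means of the test function. -/
lemma residual_cr (hΩreg : interior (closure Ω) = Ω) {u v : T.Cell → Plane → ℝ}
    {a a' : T.Cell → Plane} {c c' : T.Cell → ℝ} (hu : ∀ K x, u K x = ⟪a K, x⟫ + c K)
    (hv : ∀ K x, v K x = ⟪a' K, x⟫ + c' K) :
    (∫ x in Ω, ⟪T.glue (fun K y => act (T.projMat A K) (T.gradNC u K y) +
        T.uM A γ f u K • T.proj b K) x, T.glue (T.gradNC v) x⟫) +
      (∫ x in Ω, T.const (fun K => T.proj γ K * T.uM A γ f u K) x * T.glue v x) -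
      ∫ x in Ω, T.const (T.proj f) x * T.glue v x =
    -∑ K : T.Cell, ∑ z ∈ K.1,
      outwardFlux (T.pM A b γ f u K) z (K.1.erase z) * edgeMean (v K) (K.1.erase z) := by
  rw [sum_flux_mul_edgeMean (pM_eq hu) hv, integral_const_mul_affine hΩreg _ hv,
    integral_const_mul_affine hΩreg _ hv,
    integral_eq_sum hΩreg (G := fun K _ => ⟪act (T.projMat A K) (a K) +
        T.uM A γ f u K • T.proj b K, a' K⟫) (fun K => continuous_const)]
  · rw [← Finset.sum_add_distrib, ← Finset.sum_sub_distrib, ← Finset.sum_neg_distrib]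
    refine Finset.sum_congr rfl fun K _ => ?_
    rw [setIntegral_const, smul_eq_mul, inner_neg_left]
    ring
  · intro K x hx
    have e1 : u K = fun x => ⟪a K, x⟫ + c K := funext (hu K)
    have e2 : v K = fun x => ⟪a' K, x⟫ + c' K := funext (hv K)
    rw [glue_of_mem _ hx, glue_of_mem _ hx, gradNC, gradNC, e1, e2, gradient_affine,
      gradient_affine]
  · intro x hx
    rw [glue_of_notMem _ hx, inner_zero_left]

lemma integral_inner_act_inv (K : T.Cell) (g Q : Plane) (e d : ℝ) :
    ∫ x in hull K.1, ⟪g + e • act (T.projMat A K)⁻¹ (x - mid K.1), Q + d • (x - mid K.1)⟫ =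
      volume.real (hull K.1) * (⟪g, Q⟫ + e * d * T.S A K) := by
  set B := (T.projMat A K)⁻¹ with hB
  have hV := (T.isTriangle K).volume_pos.ne'
  have hS : ∫ x in hull K.1, ⟪x - mid K.1, act B (x - mid K.1)⟫ =
      volume.real (hull K.1) * T.S A K := by
    rw [S, setAverage_eq, smul_eq_mul, mul_inv_cancel_left₀ hV]
  have hBc := continuous_act B
  have hexp : ∀ x, ⟪g + e • act B (x - mid K.1), Q + d • (x - mid K.1)⟫ =
      (⟪d • g + e • act B.transpose Q, x⟫ +
        (⟪g, Q⟫ - ⟪d • g + e • act B.transpose Q, mid K.1⟫)) +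
      e * d * ⟪x - mid K.1, act B (x - mid K.1)⟫ := by
    intro x
    have h1 : ⟪d • g + e • act B.transpose Q, x⟫ - ⟪d • g + e • act B.transpose Q, mid K.1⟫ =
        d * ⟪g, x - mid K.1⟫ + e * ⟪act B (x - mid K.1), Q⟫ := by
      rw [inner_act_left B, ← inner_sub_right, inner_add_left, real_inner_smul_left,
        real_inner_smul_left]
    simp only [inner_add_left, inner_add_right, real_inner_smul_left, real_inner_smul_right] at h1 ⊢
    rw [real_inner_comm (act B (x - mid K.1)) (x - mid K.1)]
    linear_combination -h1
  have hi : ∀ G : Plane → ℝ, Continuous G → IntegrableOn G (hull K.1) := fun G hG =>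
    hG.continuousOn.integrableOn_compact (isCompact_hull _)
  simp only [hexp]
  rw [integral_add (hi _ ?_) (hi _ ?_), (T.isTriangle K).integral_affine,
    integral_const_mul, hS]
  · ring
  · fun_prop
  · exact continuous_const.mul
      ((continuous_id.sub continuous_const).inner (hBc.comp (continuous_id.sub continuous_const)))

/-- The residual of the first mixed equation is minus the pairing of the fluxes of the test
field with the edge means of the Crouzeix-Raviart function. -/
lemma residual_mixed (hΩ : IsOpen Ω) (hΩreg : interior (closure Ω) = Ω)
    (hdet : ∀ K : T.Cell, (T.projMat A K).det ≠ 0)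
    (hS : ∀ K : T.Cell, 1 + T.S A K / 4 * T.proj γ K ≠ 0) {u : T.Cell → Plane → ℝ}
    {a : T.Cell → Plane} {c : T.Cell → ℝ} (hu : ∀ K x, u K x = ⟪a K, x⟫ + c K)
    {q : T.Cell → Plane → Plane} (hq : T.IsRT0 q) :
    (∫ x in Ω, ⟪T.glue (fun K y => act (T.projMat A K)⁻¹ (T.pM A b γ f u K y) +
        T.uM A γ f u K • act (T.projMat A K)⁻¹ (T.proj b K)) x, T.glue q x⟫) -
      ∫ x in Ω, weakDiv Ω (T.glue q) x * T.const (T.uM A γ f u) x =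
    -∑ K : T.Cell, ∑ z ∈ K.1,
      outwardFlux (q K) z (K.1.erase z) * edgeMean (u K) (K.1.erase z) := by
  choose w d hwd using hq.shape
  have hq' : ∀ K x, q K x = (w K + d K • mid K.1) + d K • (x - mid K.1) := by
    intro K x; rw [hwd]; module
  have hdiv : ∫ x in Ω, weakDiv Ω (T.glue q) x * T.const (T.uM A γ f u) x =
      ∫ x in Ω, T.const (fun K => 2 * d K) x * T.const (T.uM A γ f u) x :=
    integral_congr_ae ((hq.weakDiv_ae_eq hΩ hΩreg hwd).mono fun x hx => by simp only [hx])
  have hp : ∀ K x, act (T.projMat A K)⁻¹ (T.pM A b γ f u K x) +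
      T.uM A γ f u K • act (T.projMat A K)⁻¹ (T.proj b K) =
      -a K + ((T.proj f K - T.proj γ K * T.uM A γ f u K) / 2) •
        act (T.projMat A K)⁻¹ (x - mid K.1) := by
    intro K x
    rw [pM_eq hu, act_add, act_neg, act_add, act_inv_act (hdet K), act_smul, act_smul]
    module
  have hproj : ∀ K, (1 + T.S A K / 4 * T.proj γ K) * T.uM A γ f u K =
      ⟪a K, mid K.1⟫ + c K + T.S A K / 4 * T.proj f K := by
    intro K
    have : u K = fun x => ⟪a K, x⟫ + c K := funext (hu K)
    rw [uM, mul_inv_cancel_left₀ (hS K), this, proj_affine]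
  rw [hdiv, integral_const_mul_const hΩreg, sum_flux_mul_edgeMean hq' hu,
    integral_eq_sum hΩreg (G := fun K x => ⟪-a K + ((T.proj f K -
      T.proj γ K * T.uM A γ f u K) / 2) • act (T.projMat A K)⁻¹ (x - mid K.1),
      (w K + d K • mid K.1) + d K • (x - mid K.1)⟫)]
  · rw [← Finset.sum_sub_distrib, ← Finset.sum_neg_distrib]
    refine Finset.sum_congr rfl fun K _ => ?_
    rw [integral_inner_act_inv, inner_neg_left, real_inner_comm (a K)]
    linear_combination (-2 * volume.real (hull K.1) * d K) * hproj K
  · intro K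
    have hBc := continuous_act (T.projMat A K)⁻¹
    have hq : Continuous fun x : Plane => (w K + d K • mid K.1) + d K • (x - mid K.1) := by
      fun_prop
    have hm : Continuous fun x : Plane => x - mid K.1 := by fun_prop
    have h1 := (hBc.comp hm).const_smul ((T.proj f K - T.proj γ K * T.uM A γ f u K) / 2)
    exact (continuous_const.add h1).inner hq
  · intro K x hx
    rw [glue_of_mem _ hx, glue_of_mem _ hx, hp, hq']
  · intro x hx
    rw [glue_of_notMem _ hx, inner_zero_left]

lemma fluxCancel_pM (hΩreg : interior (closure Ω) = Ω) {u : T.Cell → Plane → ℝ}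
    (hu : T.SolvesCR A b γ f u) : FluxCancel (T.pM A b γ f u) := by
  choose a c hac using hu.mem.affine
  refine fluxCancel_of_sum_eq_zero fun v hv => ?_
  choose a' c' hac' using hv.affine
  have h1 := residual_cr (A := A) (b := b) (γ := γ) (f := f) hΩreg hac hac'
  have h2 := hu.eqn v hv
  linarith

lemma solvesMixed_of_solvesCR (hΩ : IsOpen Ω) (hΩreg : interior (closure Ω) = Ω)
    (hdet : ∀ K : T.Cell, (T.projMat A K).det ≠ 0)
    (hS : ∀ K : T.Cell, 1 + T.S A K / 4 * T.proj γ K ≠ 0) {u : T.Cell → Plane → ℝ}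
    (hu : T.SolvesCR A b γ f u) : T.SolvesMixed A b γ f (T.pM A b γ f u) (T.uM A γ f u) := by
  choose a c hac using hu.mem.affine
  have hshape : ∀ K x, T.pM A b γ f u K x =
      (-(act (T.projMat A K) (a K) + T.uM A γ f u K • T.proj b K) -
        ((T.proj f K - T.proj γ K * T.uM A γ f u K) / 2) • mid K.1) +
      ((T.proj f K - T.proj γ K * T.uM A γ f u K) / 2) • x := by
    intro K x; rw [pM_eq hac]; module
  have hRT : T.IsRT0 (T.pM A b γ f u) :=
    isRT0_of_fluxCancel hΩreg hshape (fluxCancel_pM hΩreg hu)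
  refine ⟨hRT, fun q hq => ?_, fun v => ?_⟩
  · rw [residual_mixed hΩ hΩreg hdet hS hac hq, hq.fluxCancel.sum_eq_zero hu.mem, neg_zero]
  · have hdiv : ∫ x in Ω, weakDiv Ω (T.glue (T.pM A b γ f u)) x * T.const v x =
        ∫ x in Ω, T.const (fun K => 2 * ((T.proj f K - T.proj γ K * T.uM A γ f u K) / 2)) x *
          T.const v x :=
      integral_congr_ae ((hRT.weakDiv_ae_eq hΩ hΩreg hshape).mono fun x hx => by simp only [hx])
    rw [hdiv, integral_const_mul_const hΩreg, integral_const_mul_const hΩreg,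
      integral_const_mul_const hΩreg, ← Finset.sum_add_distrib]
    refine Finset.sum_congr rfl fun K _ => ?_
    ring

/-- A piecewise affine function is determined by the pair reconstructed from it. -/
lemma eq_of_uM_eq_of_pM_eq (hdet : ∀ K : T.Cell, (T.projMat A K).det ≠ 0)
    (hS : ∀ K : T.Cell, 1 + T.S A K / 4 * T.proj γ K ≠ 0) {u v : T.Cell → Plane → ℝ}
    (hu : T.IsCR0 u) (hv : T.IsCR0 v) (h : T.uM A γ f u = T.uM A γ f v)
    (hp : T.pM A b γ f u = T.pM A b γ f v) : u = v := by
  choose a c hac using hu.affine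
  choose a' c' hac' using hv.affine
  funext K x
  have e1 : u K = fun x => ⟪a K, x⟫ + c K := funext (hac K)
  have e2 : v K = fun x => ⟪a' K, x⟫ + c' K := funext (hac' K)
  have h1 := congrFun h K
  simp only [uM] at h1
  have h2 := mul_left_cancel₀ (inv_ne_zero (hS K)) h1
  rw [e1, e2, proj_affine, proj_affine] at h2
  have h3 := congrFun (congrFun hp K) (mid K.1)
  rw [pM_eq hac, pM_eq hac', h, sub_self, smul_zero, add_zero, add_zero, neg_inj,
    add_left_inj] at h3
  have h4 : a K = a' K := by
    rw [← act_inv_act (hdet K) (a K), h3, act_inv_act (hdet K)]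
  rw [hac, hac', h4]
  rw [h4] at h2
  linarith

lemma exists_solvesCR_of_solvesMixed (hΩ : IsOpen Ω) (hΩreg : interior (closure Ω) = Ω)
    (hdet : ∀ K : T.Cell, (T.projMat A K).det ≠ 0)
    (hS : ∀ K : T.Cell, 1 + T.S A K / 4 * T.proj γ K ≠ 0) {p : T.Cell → Plane → Plane} {w : T.P0}
    (h : T.SolvesMixed A b γ f p w) :
    ∃ u, T.SolvesCR A b γ f u ∧ w = T.uM A γ f u ∧ p = T.pM A b γ f u := by
  classical
  choose r d hrd using h.mem.shape
  have hd : ∀ K, 2 * d K = T.proj f K - T.proj γ K * w K := by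
    intro K
    have hdiv : ∫ x in Ω, weakDiv Ω (T.glue p) x * T.const (Pi.single K 1 : T.P0) x =
        ∫ x in Ω, T.const (fun K => 2 * d K) x * T.const (Pi.single K 1 : T.P0) x :=
      integral_congr_ae ((h.mem.weakDiv_ae_eq hΩ hΩreg hrd).mono fun x hx => by simp only [hx])
    have h2 := h.eqn₂ (Pi.single K 1)
    rw [hdiv, integral_const_mul_const hΩreg, integral_const_mul_const hΩreg,
      integral_const_mul_const hΩreg, ← Finset.sum_add_distrib,
      Finset.sum_eq_single_of_mem K (Finset.mem_univ _),
      Finset.sum_eq_single_of_mem K (Finset.mem_univ _)] at h2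
    · have hV := (T.isTriangle K).volume_pos.ne'
      simp only [Pi.single_eq_same, mul_one] at h2
      rw [← mul_add] at h2
      have := mul_left_cancel₀ hV h2
      linarith
    · intro L _ hL; simp [Pi.single_eq_of_ne hL]
    · intro L _ hL; simp [Pi.single_eq_of_ne hL]
  -- gradient and value at the centroid are read off from the two reconstruction formulas
  set a : T.Cell → Plane := fun K =>
    act (T.projMat A K)⁻¹ (-((r K + d K • mid K.1) + w K • T.proj b K)) with ha
  set c : T.Cell → ℝ := fun K => (1 + T.S A K / 4 * T.proj γ K) * w K - T.S A K / 4 * T.proj f K -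
    ⟪a K, mid K.1⟫ with hc
  set u : T.Cell → Plane → ℝ := fun K x => ⟪a K, x⟫ + c K with hu
  have hac : ∀ K x, u K x = ⟪a K, x⟫ + c K := fun _ _ => rfl
  have hw : w = T.uM A γ f u := by
    funext K
    rw [uM, show u K = fun x => ⟪a K, x⟫ + c K from rfl, proj_affine, hc,
      eq_inv_mul_iff_mul_eq₀ (hS K)]
    ring
  have hp : p = T.pM A b γ f u := by
    funext K x
    rw [pM_eq hac, ← hw, ← hd, hrd, ha]
    simp only
    rw [act_act_inv (hdet K)]
    module
  have hCR : T.IsCR0 u := by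
    refine isCR0_of_sum_eq_zero hΩreg hac fun q hq => ?_
    have h1 := residual_mixed (b := b) (f := f) hΩ hΩreg hdet hS hac hq
    have h2 := h.eqn₁ q hq
    rw [← hw, ← hp, h2] at h1
    linarith
  refine ⟨u, ⟨hCR, fun v hv => ?_⟩, hw, hp⟩
  choose a' c' hac' using hv.affine
  have h1 := residual_cr (A := A) (b := b) (γ := γ) (f := f) hΩreg hac hac'
  rw [← hp, h.mem.fluxCancel.sum_eq_zero hv] at h1
  linarith

end Triangulation

end

theorem mainTheorem2 (Ω : Set Plane) (hΩ : IsOpen Ω) (hΩreg : interior (closure Ω) = Ω)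
    (T : Triangulation Ω)
    (A : Plane → Matrix (Fin 2) (Fin 2) ℝ) (b : Plane → Plane) (γ f : Plane → ℝ)
    (hA : ∀ i j, MemLp (fun x => A x i j) ⊤ (volume.restrict Ω))
    (hAsymm : ∀ᵐ x ∂volume.restrict Ω, (A x).IsSymm)
    (α Λ : ℝ) (hα : 0 < α)
    (hAell : ∀ᵐ x ∂volume.restrict Ω, ∀ ξ : Plane,
      α * ‖ξ‖ ^ 2 ≤ ⟪act (A x) ξ, ξ⟫ ∧ ⟪act (A x) ξ, ξ⟫ ≤ Λ * ‖ξ‖ ^ 2)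
    (hb : MemLp b ⊤ (volume.restrict Ω))
    (hγ : MemLp γ ⊤ (volume.restrict Ω))
    (hf : MemLp f 2 (volume.restrict Ω))
    (hS : ∀ K : T.Cell, 1 + T.S A K / 4 * T.proj γ K ≠ 0) :
    (∀ u : T.Cell → Plane → ℝ, T.SolvesCR A b γ f u →
      T.IsRT0 (T.pM A b γ f u) ∧ T.SolvesMixed A b γ f (T.pM A b γ f u) (T.uM A γ f u)) ∧
    (∀ (p : T.Cell → Plane → Plane) (w : T.P0), T.SolvesMixed A b γ f p w →
      (∃! u : T.Cell → Plane → ℝ,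
        T.SolvesCR A b γ f u ∧ w = T.uM A γ f u ∧ p = T.pM A b γ f u) ∧
      (∀ u : T.Cell → Plane → ℝ, T.SolvesCR A b γ f u →
        (∀ u' : T.Cell → Plane → ℝ, T.SolvesCR A b γ f u' → u' = u) →
        w = T.uM A γ f u ∧ p = T.pM A b γ f u)) := by
  have hdet : ∀ K : T.Cell, (T.projMat A K).det ≠ 0 :=
    Triangulation.det_projMat_ne_zero hΩreg hA hα (hAell.mono fun x hx ξ => (hx ξ).1)
  refine ⟨fun u hu => ?_, fun p w h => ?_⟩
  · have hmixed := Triangulation.solvesMixed_of_solvesCR hΩ hΩreg hdet hS hu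
    exact ⟨hmixed.mem, hmixed⟩
  · obtain ⟨u, hu, hw, hp⟩ := Triangulation.exists_solvesCR_of_solvesMixed hΩ hΩreg hdet hS h
    refine ⟨⟨u, ⟨hu, hw, hp⟩, ?_⟩, ?_⟩
    · rintro v ⟨hv, hwv, hpv⟩
      exact Triangulation.eq_of_uM_eq_of_pM_eq hdet hS hv.mem hu.mem (hwv.symm.trans hw)
        (hpv.symm.trans hp)
    · intro v _ huniq
      obtain rfl := huniq u hu
      exact ⟨hw, hp⟩
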